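/- **Setting.** Let $\mathcal X\subset\mathbb R^{d_x}$, $\mathcal U\subset\mathbb R^{d_u}$, let $\mathcal T\subset(0,\infty)$ be the set of admissible step lengths, $\mathcal Z=\mathcal X\times\mathcal U$, and let $\|\cdot\|$ be the Euclidean norm. The unknown system is $x_{k+1}=h^*(z_k,\tau_k)$, $z_k=(x_k,\pi(x_k))$, with $h^*:\mathcal Z\times\mathcal T\to\mathcal X$, fixed initial state $x_0\in\mathcal X$ and fixed step lengths $\tau_k\in\mathcal T$. An episode has $T\ge1$ steps, and for a policy $\pi:\mathcal X\to\mathcal U$ and dynamics $h:\mathcal Z\times\mathcal T\to\mathcal X$ let $C(\pi,h)=\sum_{k=1}^T c(z_k)$ along the trajectory of $h$ under $\pi$. The policy class $\Pi$ consists of $L_\pi$-Lipschitz policies, $c$ is $L_c$-Lipschitz, $h^*(\cdot,\tau)$ is $L_h$-Lipschitz for each $\tau\in\mathcal T$, and $\pi^*\in\Pi$ minimizes $C(\cdot,h^*)$ over $\Pi$. Each component of $h^*$ lies in the RKHS of a measurable kernel $k$ on $\mathcal Z\times\mathcal T$, with RKHS norm at most $B$, and $k(w,w)\le\kappa$ for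 all $w$. A measurement at a visited point $w=(z_k,\tau_k)$ returns $h^*(w)+\varepsilon$, with i.i.d. noise $\varepsilon\sim\mathcal N(0,\sigma^2 I)$, $\sigma>0$, the noise of an episode being independent of everything known before that episode. From all measurements $(w_i,y_i)$ of the episodes $1,\dots,n$ form the GP posterior $$\mu_{n,j}(w)=k_n(w)^\top(K_n+\sigma^2I)^{-1}y^{j},\qquad \sigma_{n,j}(w)^2=k(w,w)-k_n(w)^\top(K_n+\sigma^2I)^{-1}k_n(w),$$ where $K_n=[k(w_i,w_l)]_{i,l}$, $k_n(w)=[k(w_i,w)]_i$ and $y^j$ is the vector of the $j$-th coordinates of the $y_i$. Let $\sigma_n=(\sigma_{n,1},\dots,\sigma_{n,d_x})$, assumed $L_\sigma$-Lipschitz in $z$, and for a nondecreasing sequence $\beta_n\ge0$ let $$\mathcal M_n=\{h:\mathcal Z\times\mathcal T\to\mathcal X \mid |\mu_{n,j}(w)-h_j(w)|\le\beta_n\sigma_{n,j}(w)\ \forall w,j\}.$$ The model is *well-calibrated* (at level $\delta$) if $h^*\in\bigcap_{n\ge0}\mathcal M_n$ with probability at least $1-\delta$. Let $\gamma_n=\sup_{w_1,\dots,w_n}\frac12\log\det(I+\sigma^{-2}[k(w_i,w_l)]_{i,l})$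 be the maximum information gain (repeated points allowed), and write $L_h'=L_h(1+L_\pi)$, $L_\sigma'=L_\sigma(1+L_\pi)$. **Algorithm (optimistic selection with the adaptive MSS).** In episode $n\ge1$, based on what is known before the episode (measurably), $(\pi_n,h_n)$ minimizes $C(\pi,h)$ over $\pi\in\Pi$, $h\in\mathcal M_{n-1}$ (an arbitrary choice with $\pi_n\in\Pi$ is made if $\mathcal M_{n-1}=\emptyset$), and $\pi_n$ is executed on $h^*$. With $\Gamma_n(\Delta)=2\beta_nL_\sigma'(1+L_h'+2\beta_nL_\sigma')^{\Delta-1}$, let $\Delta_n$ be the largest integer $1\le\Delta\le T$ with $2\Delta\,\Gamma_n(\Delta)\le1$, or $\Delta_n=1$ if there is none. The steps $0,\dots,T-1$ are split into $m_n=\lceil T/\Delta_n\rceil$ consecutive buckets of length $\Delta_n$ (the last possibly shorter). In each bucket, a trajectory of $h_n$ under $\pi_n$ is hallucinated from the true state at the start of the bucket, and one measurement of the true system is recorded, at a step of the bucket at which $\|\sigma_{n-1}\|$ is largest along the hallucinated trajectory. The regret is $R_N=\sum_{n=1}^N\bigl(C(\pi_n,h^*)-C(\pi^*,h^*)\bigr)$.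 **Theorem.** There are constants $C_R>0$, depending only on $d_x,L_c,L_\pi,\sigma,\kappa$; $C_\beta\ge1$, depending only on these and on $T,B$; and $C_m>0$, depending only on all these and on $L_h,L_\sigma$, such that for every $\delta\in(0,1)$: 1. if $\beta_n\ge C_\beta\sqrt{1+\gamma_n+\log(1/\delta)}$ for all $n\ge0$, then the model is well-calibrated; 2. whenever the model is well-calibrated, with probability at least $1-\delta$ we have, for all $N\ge1$ simultaneously, $$R_N\le C_R\,\beta_N\,T^2\,(1+L_h'+2\beta_NL_\sigma')^{T-1}\sqrt{N\gamma_N};$$ 3. $m_n\le\max\{1,C_m\beta_n\}$ for all $n\ge1$; in particular $m_n\le\max\{1,C_m\}\,\beta_n$ if $\beta_n\ge1$, as is the case in 1. -/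

import Mathlib

open MeasureTheory ProbabilityTheory

noncomputable section

/-- `ℝ^d` with the Euclidean norm. -/
abbrev Vec (d : ℕ) : Type := EuclideanSpace ℝ (Fin d)

/-- Arguments `(z, τ)` of a discretized dynamics, `z = (x, u)` being a state-action pair and `τ` the
length of the time step. -/
abbrev StepInput {dx du : ℕ} (X : Set (Vec dx)) (U : Set (Vec du)) (S : Set ℝ) : Type :=
  (X × U) × S

/-- Euclidean distance of two state-action pairs in `ℝ^dx × ℝ^du = ℝ^(dx + du)`. -/
def zDist {dx du : ℕ} {X : Set (Vec dx)} {U : Set (Vec du)} (z z' : X × U) : ℝ :=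
  Real.sqrt (‖(z.1 : Vec dx) - (z'.1 : Vec dx)‖ ^ 2 + ‖(z.2 : Vec du) - (z'.2 : Vec du)‖ ^ 2)

/-! ### Gaussian process regression -/

section GaussianProcess

variable {W : Type*}

/-- The scalar kernel of a reproducing kernel Hilbert space of real functions on `W`. -/
def rkhsKernel (H : Type*) [NormedAddCommGroup H] [InnerProductSpace ℝ H] [CompleteSpace H]
    [RKHS ℝ H W ℝ] (w w' : W) : ℝ :=
  RKHS.kernel H w w' 1

/-- Kernel matrix of a finite family of points. -/
def kernelMatrix {ι : Type*} (k : W → W → ℝ) (w : ι → W) : Matrix ι ι ℝ :=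
  Matrix.of fun i j => k (w i) (w j)

variable {ι : Type*} [Fintype ι] [DecidableEq ι]

/-- Posterior mean at `v` of a zero-mean Gaussian process with kernel `k`, given the noisy
observations `y i` at the points `w i` with noise variance `σ ^ 2`. -/
def posteriorMean (k : W → W → ℝ) (σ : ℝ) (w : ι → W) (y : ι → ℝ) (v : W) : ℝ :=
  dotProduct (fun i => k (w i) v)
    (Matrix.mulVec (kernelMatrix k w + σ ^ 2 • (1 : Matrix ι ι ℝ))⁻¹ y)

/-- Posterior variance. -/
def posteriorVar (k : W → W → ℝ) (σ : ℝ) (w : ι → W) (v : W) : ℝ :=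
  k v v - dotProduct (fun i => k (w i) v)
    (Matrix.mulVec (kernelMatrix k w + σ ^ 2 • (1 : Matrix ι ι ℝ))⁻¹ (fun i => k (w i) v))

/-- Posterior standard deviation. -/
def posteriorStd (k : W → W → ℝ) (σ : ℝ) (w : ι → W) (v : W) : ℝ :=
  Real.sqrt (posteriorVar k σ w v)

/-- Information gain of noisy observations at the points `w i`. -/
def infoGain (k : W → W → ℝ) (σ : ℝ) (w : ι → W) : ℝ :=
  1 / 2 * Real.log (1 + (σ ^ 2)⁻¹ • kernelMatrix k w).det

/-- Maximum information gain of `n` observations (points may be observed repeatedly). -/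
def maxInfoGain (k : W → W → ℝ) (σ : ℝ) (n : ℕ) : ℝ :=
  ⨆ w : Fin n → W, infoGain k σ w

end GaussianProcess

/-- `A` holds with probability at least `p`. -/
def HoldsWithProb {Ω : Type*} [MeasurableSpace Ω] (μ : Measure Ω) (p : ℝ) (A : Ω → Prop) : Prop :=
  ∃ E : Set Ω, MeasurableSet E ∧ ENNReal.ofReal p ≤ μ E ∧ ∀ ω ∈ E, A ω

/-! ### The discretized control problem -/

section Control

variable {dx du : ℕ} {X : Set (Vec dx)} {U : Set (Vec du)} {S : Set ℝ}

/-- States visited after `r` steps of the dynamics `h` under the policy `π`, if the state at step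
`s` is `x`; the step from `k` to `k + 1` has length `τ k`. -/
def rollout (h : StepInput X U S → X) (π : X → U) (τ : ℕ → S) (s : ℕ) (x : X) : ℕ → X
  | 0 => x
  | r + 1 => h ((rollout h π τ s x r, π (rollout h π τ s x r)), τ (s + r))

variable (X U S) in
/-- A control problem for an unknown discretized dynamics `hstar`. -/
structure ControlProblem where
  hstar : StepInput X U S → X
  x0 : X
  τ : ℕ → S
  /-- number of steps of an episode -/
  T : ℕ
  /-- running cost -/
  c : X × U → ℝ
  /-- policy class -/
  policies : Set (X → U)

namespace ControlProblem

variable (P : ControlProblem X U S)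

/-- `C(π, h) = ∑_{k = 1}^T c(x_k, π(x_k))`, where `x_{k+1} = h((x_k, π(x_k)), τ_k)`. -/
def cost (π : X → U) (h : StepInput X U S → X) : ℝ :=
  ∑ k ∈ Finset.Icc 1 P.T, P.c (rollout h π P.τ 0 P.x0 k, π (rollout h π P.τ 0 P.x0 k))

/-- The Lipschitz assumptions on the true dynamics, the cost and the policies. -/
structure IsLipschitz (Lh Lc Lπ : ℝ) : Prop where
  hstar : ∀ (t : S) (z z' : X × U),
    ‖(P.hstar (z, t) : Vec dx) - (P.hstar (z', t) : Vec dx)‖ ≤ Lh * zDist z z'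
  cost : ∀ z z' : X × U, |P.c z - P.c z'| ≤ Lc * zDist z z'
  policy : ∀ π ∈ P.policies, ∀ x x' : X,
    ‖(π x : Vec du) - (π x' : Vec du)‖ ≤ Lπ * ‖(x : Vec dx) - (x' : Vec dx)‖

/-- `hstar ∈ H_B^dx`: each component is an element of norm at most `B` of the RKHS `H`. -/
def InRKHSBall (H : Type*) [NormedAddCommGroup H] [InnerProductSpace ℝ H]
    [RKHS ℝ H (StepInput X U S) ℝ] (B : ℝ) : Prop :=
  ∀ j : Fin dx, ∃ f : H, ‖f‖ ≤ B ∧ ∀ w, f w = (P.hstar w : Vec dx) j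

end ControlProblem

/-- The constants that define the learner: kernel, noise level, Lipschitz constants of the policies,
the true dynamics and the posterior standard deviations, and confidence widths `β n`. -/
structure LearnerParams (X : Set (Vec dx)) (U : Set (Vec du)) (S : Set ℝ) where
  k : StepInput X U S → StepInput X U S → ℝ
  σ : ℝ
  Lπ : ℝ
  Lh : ℝ
  Lσ : ℝ
  β : ℕ → ℝ

namespace LearnerParams

variable (L : LearnerParams X U S)

/-- Growth factor `1 + L_h' + 2 β_n L_σ'` of deviations between true and hallucinated states, where
`L_h' = L_h (1 + L_π)` and `L_σ' = L_σ (1 + L_π)`. -/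
def growth (n : ℕ) : ℝ := 1 + L.Lh * (1 + L.Lπ) + 2 * L.β n * (L.Lσ * (1 + L.Lπ))

/-- The discrete-time constant `Γ_n(Δ)`. -/
def Gam (n Δ : ℕ) : ℝ := 2 * L.β n * (L.Lσ * (1 + L.Lπ)) * L.growth n ^ (Δ - 1)

open Classical in
/-- Bucket length (number of steps) in episode `n`: the largest `Δ ≤ T` with
`Δ ≤ 1 / (2 Γ_n(Δ))`, but at least one step. -/
def bucketLength (T n : ℕ) : ℕ :=
  max 1 (Nat.findGreatest (fun Δ => 2 * L.Gam n Δ * (Δ : ℝ) ≤ 1) T)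

/-- Number `m_n` of buckets, which is the number of measurements of the adaptive strategy in
episode `n`. -/
def numMeas (T n : ℕ) : ℕ := ⌈(T : ℝ) / (L.bucketLength T n : ℝ)⌉₊

/-- The steps in bucket `i` (counted from `0`) of episode `n`. -/
def bucket (T n i : ℕ) : Finset ℕ :=
  Finset.Ico (i * L.bucketLength T n) (min ((i + 1) * L.bucketLength T n) T)

end LearnerParams

/-! ### Interaction of the learner with the system -/

/-- The random quantities of the interaction over the episodes `n = 1, 2, …`:
the information `ℱ n` available after episode `n`, the measurement noise `noise n i j` (episode,
measurement, coordinate), the policy and the hallucinated dynamics of episode `n`, and the step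
`time n i` of the measurement in bucket `i` of episode `n`. -/
structure Interaction (X : Set (Vec dx)) (U : Set (Vec du)) (S : Set ℝ)
    (Ω : Type*) [mΩ : MeasurableSpace Ω] where
  ℱ : Filtration ℕ mΩ
  noise : ℕ → ℕ → Fin dx → Ω → ℝ
  policy : ℕ → Ω → X → U
  model : ℕ → Ω → StepInput X U S → X
  time : ℕ → ℕ → Ω → ℕ

namespace Interaction

variable {Ω : Type*} [mΩ : MeasurableSpace Ω]
variable (R : Interaction X U S Ω) (P : ControlProblem X U S) (L : LearnerParams X U S)

/-- The true state `x_{n,k}`. -/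
def state (n k : ℕ) (ω : Ω) : X := rollout P.hstar (R.policy n ω) P.τ 0 P.x0 k

/-- The point `(z_{n,k}, τ_k)` on the true trajectory. -/
def point (n k : ℕ) (ω : Ω) : StepInput X U S :=
  ((R.state P n k ω, R.policy n ω (R.state P n k ω)), P.τ k)

/-- The point at which measurement `i` of episode `n` is taken. -/
def measPoint (n i : ℕ) (ω : Ω) : StepInput X U S := R.point P n (R.time n i ω) ω

/-- The `j`-th coordinate of measurement `i` of episode `n`: the next state plus noise. -/
def meas (n i : ℕ) (j : Fin dx) (ω : Ω) : ℝ :=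
  (P.hstar (R.measPoint P n i ω) : Vec dx) j + R.noise n i j ω

/-- Indices of all the measurements taken in the episodes `1, …, n`: the pair `⟨l, i⟩` stands for
measurement `i` of episode `l + 1`. -/
abbrev DataIdx (L : LearnerParams X U S) (T n : ℕ) : Type :=
  (l : Fin n) × Fin (L.numMeas T (l + 1))

/-- Posterior mean `μ_{n,j}` after the episodes `1, …, n`. -/
def mean (n : ℕ) (ω : Ω) (j : Fin dx) (v : StepInput X U S) : ℝ :=
  posteriorMean L.k L.σ (fun p : DataIdx L P.T n => R.measPoint P (p.1 + 1) p.2 ω)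
    (fun p => R.meas P (p.1 + 1) p.2 j ω) v

/-- Posterior standard deviation vector `σ_n` after the episodes `1, …, n`. All components are equal
because they share the kernel and the measured points. -/
def std (n : ℕ) (ω : Ω) (v : StepInput X U S) : Vec dx :=
  WithLp.toLp 2 fun _ : Fin dx =>
    posteriorStd L.k L.σ (fun p : DataIdx L P.T n => R.measPoint P (p.1 + 1) p.2 ω) v

/-- The set `M_n` of plausible dynamics after the episodes `1, …, n`. -/
def confSet (n : ℕ) (ω : Ω) : Set (StepInput X U S → X) :=
  {h | ∀ (v : StepInput X U S) (j : Fin dx),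
    |R.mean P L n ω j v - (h v : Vec dx) j| ≤ L.β n * R.std P L n ω v j}

/-- The point at step `t` of the trajectory that is hallucinated in bucket `i` of episode `n`,
starting from the true state at the first step of the bucket. -/
def hallPoint (n i : ℕ) (ω : Ω) (t : ℕ) : StepInput X U S :=
  let s := i * L.bucketLength P.T n
  let x := rollout (R.model n ω) (R.policy n ω) P.τ s (R.state P n s ω) (t - s)
  ((x, R.policy n ω x), P.τ t)

/-- Cumulative regret of the first `N` episodes with respect to the policy `πstar`. -/
def regret (πstar : X → U) (N : ℕ) (ω : Ω) : ℝ :=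
  ∑ n ∈ Finset.Icc 1 N, (P.cost (R.policy n ω) P.hstar - P.cost πstar P.hstar)

/-- The measurement noise is i.i.d. `N(0, σ² I)`, and the noise of episode `n` is independent of
what is known before that episode. -/
structure IsGaussianNoise (σ : ℝ) (μ : Measure Ω) : Prop where
  adapted : ∀ n i j, Measurable[R.ℱ n] (R.noise n i j)
  law : ∀ n i j, HasLaw (R.noise n i j) (gaussianReal 0 (σ ^ 2).toNNReal) μ
  indep : iIndepFun (fun (p : ℕ × ℕ × Fin dx) => R.noise p.1 p.2.1 p.2.2) μ
  indep_past : ∀ n, 1 ≤ n →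
    Indep (⨆ i : ℕ, ⨆ j : Fin dx, MeasurableSpace.comap (R.noise n i j) inferInstance)
      (R.ℱ (n - 1)) μ

/-- The optimistic algorithm with the adaptive measurement selection strategy. -/
structure IsOCoRL : Prop where
  policy_mem : ∀ n, 1 ≤ n → ∀ ω, R.policy n ω ∈ P.policies
  /-- the policy of episode `n` depends on what is known before the episode -/
  policy_predictable : ∀ n, 1 ≤ n → ∀ x : X, Measurable[R.ℱ (n - 1)] fun ω => R.policy n ω x
  time_predictable : ∀ n, 1 ≤ n → ∀ i < L.numMeas P.T n, Measurable[R.ℱ (n - 1)] (R.time n i)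
  /-- optimistic choice: `(π_n, h_n)` minimizes the cost over all policies and plausible models -/
  optimistic : ∀ n, 1 ≤ n → ∀ ω, (R.confSet P L (n - 1) ω).Nonempty →
    R.model n ω ∈ R.confSet P L (n - 1) ω ∧
      ∀ π ∈ P.policies, ∀ h ∈ R.confSet P L (n - 1) ω,
        P.cost (R.policy n ω) (R.model n ω) ≤ P.cost π h
  /-- in every bucket the measurement is taken at the step at which the hallucinated trajectory is
  the most uncertain -/
  time_mem : ∀ n, 1 ≤ n → ∀ i < L.numMeas P.T n, ∀ ω, R.time n i ω ∈ L.bucket P.T n i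
  time_max : ∀ n, 1 ≤ n → ∀ i < L.numMeas P.T n, ∀ ω, ∀ t ∈ L.bucket P.T n i,
    ‖R.std P L (n - 1) ω (R.hallPoint P L n i ω t)‖ ≤
      ‖R.std P L (n - 1) ω (R.hallPoint P L n i ω (R.time n i ω))‖

/-- The posterior standard deviations are `L_σ`-Lipschitz in the state-action pair. -/
def StdLipschitz : Prop :=
  ∀ (n : ℕ) (ω : Ω) (t : S) (z z' : X × U),
    ‖R.std P L n ω (z, t) - R.std P L n ω (z', t)‖ ≤ L.Lσ * zDist z z'

/-- All-time well-calibration: with probability at least `1 - δ`, `hstar ∈ ⋂_{n ≥ 0} M_n`. -/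
def WellCalibrated (μ : Measure Ω) (δ : ℝ) : Prop :=
  HoldsWithProb μ (1 - δ) fun ω => ∀ n, P.hstar ∈ R.confSet P L n ω

end Interaction

end Control

end

/-! Write the kernel as `k v v' = ⟪φ v, φ v'⟫`; for the RKHS, `φ` is the kernel section. The
posterior variance at `v` is then the minimum over `b` of `‖φ v - ∑ bᵢ φ(wᵢ)‖² + σ² ∑ bᵢ²`, which
makes it monotone in the data and controls the error of the posterior mean.

Calibration. For a regression function `f`, the error of the mean is at most `(‖f‖ + √Q) σ_n`, with
`Q = σ⁻²|ε|² - εᵀ(K + σ²I)⁻¹ε` (`abs_posteriorMean_sub_le`). Here `Q/2` minus the information gain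
is the log-likelihood ratio of `N(0, K + σ²I)` to `N(0, σ²I)` at the noise `ε`. The points of an
episode are determined before its noise, so along the episodes this ratio is a martingale of mean 1,
even though the design is adaptive (`setLIntegral_noiseRatio_succ`). Ville's inequality bounds it
for all `n` at once. The information gain of the data is at most `T γ_n` by subadditivity, so `β_n`
of order `√(1 + γ_n + log (1/δ))` suffices, with a factor depending on `T`.

Regret. On the calibrated event, optimism replaces the regret of an episode by the cost difference
of one policy under the true and the hallucinated dynamics. A discrete Gronwall inequality bounds
this by the uncertainties along the true trajectory (`cost_sub_cost_le`). Buckets are so short that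
true and hallucinated uncertainties differ by at most half of the hallucinated maximum, so some
measured point has at least a third of the uncertainty of every visited point
(`exists_measPoint_std_ge`). Keeping one such point per episode, the variances sum to `O(γ_N)`
(`sum_posteriorVar_le`), and Cauchy-Schwarz gives `√(N γ_N)`.

Number of measurements. Either `C_m β_n ≥ T` and the trivial bound `T` suffices, or `β_n` is so
small that a single bucket covers the episode. -/

noncomputable section

/-! ### Gaussian process regression in a Hilbert space -/

section Regression

open Matrix

variable {W ι : Type*} [Fintype ι] [DecidableEq ι]

/-- The regularized kernel matrix `K + σ² I`. -/
def regMatrix (k : W → W → ℝ) (σ : ℝ) (w : ι → W) : Matrix ι ι ℝ :=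
  kernelMatrix k w + σ ^ 2 • (1 : Matrix ι ι ℝ)

/-- The coefficients of the observations in the posterior mean at `v`. -/
def weights (k : W → W → ℝ) (σ : ℝ) (w : ι → W) (v : W) : ι → ℝ :=
  (regMatrix k σ w)⁻¹ *ᵥ fun i => k (w i) v

/-- The quadratic form `εᵀ (K + σ² I)⁻¹ ε`. -/
def quadForm (k : W → W → ℝ) (σ : ℝ) (w : ι → W) (ε : ι → ℝ) : ℝ :=
  ε ⬝ᵥ ((regMatrix k σ w)⁻¹ *ᵥ ε)

lemma regMatrix_mulVec_apply (k : W → W → ℝ) (σ : ℝ) (w : ι → W) (x : ι → ℝ) (i : ι) :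
    (regMatrix k σ w *ᵥ x) i = ∑ l, k (w i) (w l) * x l + σ ^ 2 * x i := by
  rw [regMatrix, add_mulVec, smul_mulVec, one_mulVec]
  simp [mulVec, dotProduct, kernelMatrix]

variable {H : Type*} [NormedAddCommGroup H] [InnerProductSpace ℝ H]
variable {k : W → W → ℝ} {φ : W → H} {σ : ℝ}

lemma posDef_regMatrix (hk : ∀ v v', k v v' = inner ℝ (φ v) (φ v')) (hσ : 0 < σ) (w : ι → W) :
    (regMatrix k σ w).PosDef := by
  have h : kernelMatrix k w = Matrix.gram ℝ (fun i => φ (w i)) := by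
    ext i j
    simp [kernelMatrix, Matrix.gram, hk]
  unfold regMatrix
  rw [h]
  exact Matrix.PosDef.posSemidef_add (Matrix.posSemidef_gram ℝ _)
    (Matrix.PosDef.one.smul (by positivity))

lemma isUnit_det_regMatrix (hk : ∀ v v', k v v' = inner ℝ (φ v) (φ v')) (hσ : 0 < σ)
    (w : ι → W) : IsUnit (regMatrix k σ w).det :=
  (posDef_regMatrix hk hσ w).det_pos.ne'.isUnit

lemma regMatrix_mulVec_inv (hk : ∀ v v', k v v' = inner ℝ (φ v) (φ v')) (hσ : 0 < σ)
    (w : ι → W) (y : ι → ℝ) : regMatrix k σ w *ᵥ ((regMatrix k σ w)⁻¹ *ᵥ y) = y := by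
  rw [mulVec_mulVec, mul_nonsing_inv _ (isUnit_det_regMatrix hk hσ w), one_mulVec]

/-- Lets the inverse be evaluated by exhibiting a solution of the linear system, as is done when an
observation is added. -/
lemma quadForm_eq_of_mulVec_eq (hk : ∀ v v', k v v' = inner ℝ (φ v) (φ v')) (hσ : 0 < σ)
    {w : ι → W} {ε x : ι → ℝ} (h : regMatrix k σ w *ᵥ x = ε) :
    quadForm k σ w ε = ε ⬝ᵥ x := by
  rw [quadForm, ← h, mulVec_mulVec, nonsing_inv_mul _ (isUnit_det_regMatrix hk hσ w), one_mulVec]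

lemma inv_mulVec_dotProduct_comm (hk : ∀ v v', k v v' = inner ℝ (φ v) (φ v')) (hσ : 0 < σ)
    (w : ι → W) (x y : ι → ℝ) :
    x ⬝ᵥ ((regMatrix k σ w)⁻¹ *ᵥ y) = ((regMatrix k σ w)⁻¹ *ᵥ x) ⬝ᵥ y := by
  have h : ((regMatrix k σ w)⁻¹)ᵀ = (regMatrix k σ w)⁻¹ := by
    simpa [IsHermitian] using (posDef_regMatrix hk hσ w).inv.isHermitian
  rw [dotProduct_mulVec, ← mulVec_transpose, h]

lemma posteriorMean_eq_weights (hk : ∀ v v', k v v' = inner ℝ (φ v) (φ v')) (hσ : 0 < σ)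
    (w : ι → W) (y : ι → ℝ) (v : W) :
    posteriorMean k σ w y v = ∑ i, weights k σ w v i * y i :=
  inv_mulVec_dotProduct_comm hk hσ w _ y

lemma posteriorVar_eq_weights (w : ι → W) (v : W) :
    posteriorVar k σ w v = k v v - ∑ i, k (w i) v * weights k σ w v i := rfl

/-- The regResidual of the regularized projection of `φ v` to the span of the features of `w`. -/
def regResidual (k : W → W → ℝ) (φ : W → H) (σ : ℝ) (w : ι → W) (v : W) : H :=
  φ v - ∑ i, weights k σ w v i • φ (w i)

/-- These are the normal equations of the regularized projection: the `i`-th row of `(K + σ²I) a =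
k(v)`. -/
lemma inner_residual (hk : ∀ v v', k v v' = inner ℝ (φ v) (φ v')) (hσ : 0 < σ)
    (w : ι → W) (v : W) (i : ι) :
    inner ℝ (φ (w i)) (regResidual k φ σ w v) = σ ^ 2 * weights k σ w v i := by
  have h := congrFun (regMatrix_mulVec_inv hk hσ w fun i => k (w i) v) i
  rw [regMatrix_mulVec_apply] at h
  simp only [regResidual, inner_sub_right, inner_sum, inner_smul_right, ← hk]
  change _ + σ ^ 2 * weights k σ w v i = _ at h
  rw [← h, add_comm, add_sub_assoc, add_eq_left, sub_eq_zero]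
  exact Finset.sum_congr rfl fun l _ => mul_comm _ _

/-- The inner product of the residual with `φ v` is the posterior variance; expanding its other
argument by the normal equations leaves the penalty `σ² ∑ aᵢ²`. -/
lemma posteriorVar_eq_residual (hk : ∀ v v', k v v' = inner ℝ (φ v) (φ v')) (hσ : 0 < σ)
    (w : ι → W) (v : W) :
    posteriorVar k σ w v = ‖regResidual k φ σ w v‖ ^ 2 + σ ^ 2 * ∑ i, weights k σ w v i ^ 2 := by
  have h1 : inner ℝ (φ v) (regResidual k φ σ w v) = posteriorVar k σ w v := by
    simp only [posteriorVar_eq_weights, regResidual, inner_sub_right, inner_sum, inner_smul_right,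
      ← hk]
    congr 1
    refine Finset.sum_congr rfl fun i _ => ?_
    rw [hk v, hk (w i), real_inner_comm, mul_comm]
  have h2 : ‖regResidual k φ σ w v‖ ^ 2 = inner ℝ (φ v) (regResidual k φ σ w v) -
      ∑ i, weights k σ w v i * (σ ^ 2 * weights k σ w v i) := by
    rw [← real_inner_self_eq_norm_sq]
    conv_lhs => enter [2]; rw [regResidual]
    simp only [inner_sub_left, sum_inner, inner_smul_left, inner_residual hk hσ]
    simp
  rw [h2, h1, Finset.mul_sum, sub_add, eq_comm, sub_eq_self, ← Finset.sum_sub_distrib]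
  exact Finset.sum_eq_zero fun i _ => by ring

/-- Equality holds at `b = a`, the weights. For other `b`, the terms linear in `b - a` cancel by the
normal equations and the quadratic remainder is nonnegative. -/
lemma posteriorVar_le (hk : ∀ v v', k v v' = inner ℝ (φ v) (φ v')) (hσ : 0 < σ)
    (w : ι → W) (v : W) (b : ι → ℝ) :
    posteriorVar k σ w v ≤ ‖φ v - ∑ i, b i • φ (w i)‖ ^ 2 + σ ^ 2 * ∑ i, b i ^ 2 := by
  set a := weights k σ w v with ha
  set d : H := ∑ i, (b i - a i) • φ (w i) with hd
  have h1 : φ v - ∑ i, b i • φ (w i) = regResidual k φ σ w v - d := by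
    simp only [regResidual, hd, sub_smul, Finset.sum_sub_distrib, ← ha]
    abel
  have h2 : inner ℝ (regResidual k φ σ w v) d = ∑ i, (b i - a i) * (σ ^ 2 * a i) := by
    rw [real_inner_comm]
    simp only [hd, sum_inner, inner_smul_left, inner_residual hk hσ, ← ha]
    simp
  rw [h1, norm_sub_sq_real, h2, posteriorVar_eq_residual hk hσ, ← ha]
  have h3 : σ ^ 2 * ∑ i, b i ^ 2 = σ ^ 2 * ∑ i, a i ^ 2 + 2 * ∑ i, (b i - a i) * (σ ^ 2 * a i) +
      σ ^ 2 * ∑ i, (b i - a i) ^ 2 := by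
    simp only [Finset.mul_sum, ← Finset.sum_add_distrib]
    exact Finset.sum_congr rfl fun i _ => by ring
  have h4 : 0 ≤ σ ^ 2 * ∑ i, (b i - a i) ^ 2 := by positivity
  have h5 : 0 ≤ ‖d‖ ^ 2 := by positivity
  linarith

lemma posteriorVar_nonneg (hk : ∀ v v', k v v' = inner ℝ (φ v) (φ v')) (hσ : 0 < σ)
    (w : ι → W) (v : W) : 0 ≤ posteriorVar k σ w v := by
  rw [posteriorVar_eq_residual hk hσ]
  positivity

lemma posteriorVar_le_self (hk : ∀ v v', k v v' = inner ℝ (φ v) (φ v')) (hσ : 0 < σ)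
    (w : ι → W) (v : W) : posteriorVar k σ w v ≤ k v v := by
  simpa [hk] using posteriorVar_le hk hσ w v 0

lemma sum_extend_zero {ι' M : Type*} [Fintype ι'] [AddCommMonoid M] {f : ι' → ι}
    (hf : Function.Injective f) (F : ι → ℝ → M) (hF : ∀ i, F i 0 = 0) (a : ι' → ℝ) :
    ∑ i, F i (Function.extend f a 0 i) = ∑ i', F (f i') (a i') := by
  rw [← Finset.sum_subset (Finset.subset_univ (Finset.univ.image f)),
    Finset.sum_image fun x _ y _ h => hf h]
  · exact Finset.sum_congr rfl fun i' _ => by rw [hf.extend_apply]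
  · intro i _ hi
    rw [Function.extend_apply' _ _ _ (by simpa using hi), Pi.zero_apply, hF]

/-- More observations decrease the posterior variance. -/
lemma posteriorVar_le_comp {ι' : Type*} [Fintype ι'] [DecidableEq ι']
    (hk : ∀ v v', k v v' = inner ℝ (φ v) (φ v')) (hσ : 0 < σ) (w : ι → W) (v : W) {f : ι' → ι}
    (hf : Function.Injective f) :
    posteriorVar k σ w v ≤ posteriorVar k σ (fun i => w (f i)) v := by
  set a := weights k σ (fun i => w (f i)) v with ha
  -- The optimal weights of the smaller data set, padded by zeros, compete in the larger
  -- minimization.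
  refine (posteriorVar_le hk hσ w v (Function.extend f a 0)).trans_eq ?_
  rw [posteriorVar_eq_residual hk hσ, regResidual,
    sum_extend_zero hf (fun i x => x • φ (w i)) (by simp),
    sum_extend_zero hf (fun _ x => x ^ 2) (by simp)]

lemma posteriorStd_sq (hk : ∀ v v', k v v' = inner ℝ (φ v) (φ v')) (hσ : 0 < σ)
    (w : ι → W) (v : W) : posteriorStd k σ w v ^ 2 = posteriorVar k σ w v :=
  Real.sq_sqrt (posteriorVar_nonneg hk hσ w v)

/-- The bias of the posterior mean is the inner product of `f` with the residual, whose norm is at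
most the posterior standard deviation. -/
lemma abs_inner_residual_le (hk : ∀ v v', k v v' = inner ℝ (φ v) (φ v')) (hσ : 0 < σ)
    (w : ι → W) (v : W) (f : H) :
    |inner ℝ f (φ v) - ∑ i, weights k σ w v i * inner ℝ f (φ (w i))| ≤
      ‖f‖ * posteriorStd k σ w v := by
  have h : inner ℝ f (φ v) - ∑ i, weights k σ w v i * inner ℝ f (φ (w i)) =
      inner ℝ f (regResidual k φ σ w v) := by
    simp [regResidual, inner_sub_right, inner_sum, inner_smul_right]
  rw [h]
  refine (abs_real_inner_le_norm _ _).trans (mul_le_mul_of_nonneg_left ?_ (norm_nonneg _))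
  refine Real.le_sqrt_of_sq_le ?_
  rw [posteriorVar_eq_residual hk hσ]
  have : 0 ≤ σ ^ 2 * ∑ i, weights k σ w v i ^ 2 := by positivity
  linarith

/-- Cauchy-Schwarz in `H × ℝ^ι` for the vectors `(r, σ a)` and `(g, σ⁻¹ ⟪g, φ(wᵢ)⟫)`, `r` being the
residual and `a` the weights; the squared norms are the two factors on the right. -/
lemma inner_sq_le_posteriorVar_mul (hk : ∀ v v', k v v' = inner ℝ (φ v) (φ v')) (hσ : 0 < σ)
    (w : ι → W) (v : W) (g : H) :
    inner ℝ g (φ v) ^ 2 ≤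
      posteriorVar k σ w v * (‖g‖ ^ 2 + (σ ^ 2)⁻¹ * ∑ i, inner ℝ g (φ (w i)) ^ 2) := by
  set a := weights k σ w v with ha
  set r := regResidual k φ σ w v with hr
  have h : inner ℝ g (φ v) = inner ℝ g r + ∑ i, a i * inner ℝ g (φ (w i)) := by
    simp [hr, ha, regResidual, inner_sub_right, inner_sum, inner_smul_right]
  have hcs := Finset.sum_mul_sq_le_sq_mul_sq Finset.univ a fun i => inner ℝ g (φ (w i))
  have hin : (inner ℝ g r) ^ 2 ≤ ‖g‖ ^ 2 * ‖r‖ ^ 2 := by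
    rw [← mul_pow, ← sq_abs]
    exact pow_le_pow_left₀ (abs_nonneg _) (abs_real_inner_le_norm _ _) 2
  rw [posteriorVar_eq_residual hk hσ, ← ha, ← hr, h]
  set p := inner ℝ g r
  set q := ∑ i, a i * inner ℝ g (φ (w i))
  set A := ∑ i, a i ^ 2
  set G := ∑ i, inner ℝ g (φ (w i)) ^ 2
  have hA : 0 ≤ A := by positivity
  have hG : 0 ≤ G := by positivity
  have e : (‖r‖ ^ 2 + σ ^ 2 * A) * (‖g‖ ^ 2 + (σ ^ 2)⁻¹ * G) =
      ‖g‖ ^ 2 * ‖r‖ ^ 2 + A * G + (‖r‖ ^ 2 * ((σ ^ 2)⁻¹ * G) + σ ^ 2 * A * ‖g‖ ^ 2) := by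
    field_simp
    ring
  rw [e]
  have hpq : (2 * (p * q)) ≤ ‖r‖ ^ 2 * ((σ ^ 2)⁻¹ * G) + σ ^ 2 * A * ‖g‖ ^ 2 := by
    set x := ‖r‖ ^ 2 * ((σ ^ 2)⁻¹ * G)
    set y := σ ^ 2 * A * ‖g‖ ^ 2
    have hx : 0 ≤ x := by positivity
    have hy : 0 ≤ y := by positivity
    have hxy : (p * q) ^ 2 ≤ x * y := by
      calc (p * q) ^ 2 = p ^ 2 * q ^ 2 := by ring
        _ ≤ (‖g‖ ^ 2 * ‖r‖ ^ 2) * (A * G) := by gcongr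
        _ = x * y := by simp only [x, y]; field_simp
    nlinarith [abs_le_of_sq_le_sq (a := 2 * (p * q)) (b := x + y)
      (by nlinarith [sq_nonneg (x - y)]) (by positivity), le_abs_self (2 * (p * q))]
  nlinarith

/-- The posterior mean of pure noise is `⟪g, φ v⟫` with `g = ∑ bᵢ φ(wᵢ)`, `b = (K + σ²I)⁻¹ ε`. For
this `g`, `⟪g, φ(wᵢ)⟫ = εᵢ - σ² bᵢ`, and the second factor of the preceding Cauchy-Schwarz bound
collapses to the stated one. -/
lemma posteriorMean_sq_le (hk : ∀ v v', k v v' = inner ℝ (φ v) (φ v')) (hσ : 0 < σ)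
    (w : ι → W) (v : W) (ε : ι → ℝ) :
    posteriorMean k σ w ε v ^ 2 ≤
      posteriorVar k σ w v * ((σ ^ 2)⁻¹ * ∑ i, ε i ^ 2 - quadForm k σ w ε) := by
  set b := (regMatrix k σ w)⁻¹ *ᵥ ε with hb
  set g : H := ∑ i, b i • φ (w i) with hg
  have hw : ∀ i, inner ℝ g (φ (w i)) = ε i - σ ^ 2 * b i := by
    intro i
    have h := congrFun (regMatrix_mulVec_inv hk hσ w ε) i
    rw [regMatrix_mulVec_apply] at h
    rw [← h, ← hb, add_sub_cancel_right, real_inner_comm]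
    simp only [hg, inner_sum, inner_smul_right, hk, mul_comm]
  have hm : posteriorMean k σ w ε v = inner ℝ g (φ v) := by
    simp only [hg, sum_inner, inner_smul_left]
    change ∑ i, k (w i) v * b i = _
    simp [hk, mul_comm]
  have hn : ‖g‖ ^ 2 = ∑ i, b i * (ε i - σ ^ 2 * b i) := by
    rw [← real_inner_self_eq_norm_sq]
    conv_lhs => enter [3]; rw [hg]
    simp [inner_sum, inner_smul_right, hw]
  have hq : quadForm k σ w ε = ∑ i, ε i * b i := rfl
  rw [hm]
  refine (inner_sq_le_posteriorVar_mul hk hσ w v g).trans_eq ?_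
  congr 1
  simp only [hn, hw, hq, Finset.mul_sum, ← Finset.sum_add_distrib, ← Finset.sum_sub_distrib]
  refine Finset.sum_congr rfl fun i _ => ?_
  field_simp
  ring

/-- The error of the posterior mean, if the regression function is an element of the Hilbert
space. -/
lemma abs_posteriorMean_sub_le (hk : ∀ v v', k v v' = inner ℝ (φ v) (φ v')) (hσ : 0 < σ)
    (w : ι → W) (ε : ι → ℝ) (f : H) (v : W) :
    |posteriorMean k σ w (fun i => inner ℝ f (φ (w i)) + ε i) v - inner ℝ f (φ v)| ≤
      (‖f‖ + Real.sqrt ((σ ^ 2)⁻¹ * ∑ i, ε i ^ 2 - quadForm k σ w ε)) *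
        posteriorStd k σ w v := by
  have h : posteriorMean k σ w (fun i => inner ℝ f (φ (w i)) + ε i) v - inner ℝ f (φ v) =
      posteriorMean k σ w ε v -
        (inner ℝ f (φ v) - ∑ i, weights k σ w v i * inner ℝ f (φ (w i))) := by
    simp only [posteriorMean_eq_weights hk hσ, mul_add, Finset.sum_add_distrib]
    ring
  rw [h, add_mul]
  refine (abs_sub _ _).trans ?_
  rw [add_comm]
  refine add_le_add (abs_inner_residual_le hk hσ w v f) ?_
  rw [posteriorStd, mul_comm, ← Real.sqrt_mul (posteriorVar_nonneg hk hσ w v)]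
  exact Real.abs_le_sqrt (posteriorMean_sq_le hk hσ w v ε)

/-! ### Adding one observation -/

lemma regMatrix_sumElim {ι : Type*} [DecidableEq ι] (w : ι → W) (v : W)
    (hsymm : ∀ v v', k v v' = k v' v) :
    regMatrix k σ (Sum.elim w fun _ : Unit => v) =
      fromBlocks (regMatrix k σ w) (of fun i _ => k (w i) v) (of fun _ i => k (w i) v)
        (of fun _ _ => k v v + σ ^ 2) := by
  ext (i | i) (j | j) <;>
    simp [regMatrix, kernelMatrix, Matrix.one_apply, hsymm v]

lemma kernel_symm (hk : ∀ v v', k v v' = inner ℝ (φ v) (φ v')) (v v' : W) : k v v' = k v' v := by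
  rw [hk, hk, real_inner_comm]

/-- The Schur complement of the old block is the posterior variance plus `σ²`. -/
lemma det_regMatrix_sumElim (hk : ∀ v v', k v v' = inner ℝ (φ v) (φ v')) (hσ : 0 < σ)
    (w : ι → W) (v : W) :
    (regMatrix k σ (Sum.elim w fun _ : Unit => v)).det =
      (regMatrix k σ w).det * (posteriorVar k σ w v + σ ^ 2) := by
  have : Invertible (regMatrix k σ w) := invertibleOfIsUnitDet _ (isUnit_det_regMatrix hk hσ w)
  rw [regMatrix_sumElim w v (kernel_symm hk), det_fromBlocks₁₁, det_unique (n := Unit),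
    Matrix.mul_assoc]
  congr 1
  simp only [invOf_eq_nonsing_inv, Matrix.sub_apply, of_apply, Matrix.mul_apply]
  change _ - ∑ i, k (w i) v * weights k σ w v i = _
  rw [posteriorVar_eq_weights]
  ring

/-- Chain rule for the Gaussian exponent: a new observation contributes its squared prediction error
over the predictive variance. -/
lemma quadForm_sumElim (hk : ∀ v v', k v v' = inner ℝ (φ v) (φ v')) (hσ : 0 < σ)
    (w : ι → W) (v : W) (ε : ι → ℝ) (e : ℝ) :
    quadForm k σ (Sum.elim w fun _ : Unit => v) (Sum.elim ε fun _ => e) = quadForm k σ w ε +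
      (e - posteriorMean k σ w ε v) ^ 2 / (posteriorVar k σ w v + σ ^ 2) := by
  set s := posteriorVar k σ w v with hs
  set m := posteriorMean k σ w ε v with hm
  have hs0 : 0 < s + σ ^ 2 :=
    add_pos_of_nonneg_of_pos (posteriorVar_nonneg hk hσ w v) (by positivity)
  set c := (e - m) / (s + σ ^ 2) with hc
  set a := weights k σ w v with ha
  set b := (regMatrix k σ w)⁻¹ *ᵥ ε with hb
  -- Block elimination: the last coordinate is the normalized prediction error `c`, and the old
  -- coordinates `b` are corrected by `c` times the weights.
  have hx : regMatrix k σ (Sum.elim w fun _ : Unit => v) *ᵥ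
      (Sum.elim (fun i => b i - c * a i) fun _ => c) = Sum.elim ε fun _ => e := by
    ext (i | i)
    · have h1 := congrFun (regMatrix_mulVec_inv hk hσ w ε) i
      have h2 := congrFun (regMatrix_mulVec_inv hk hσ w fun i => k (w i) v) i
      rw [regMatrix_mulVec_apply] at h1 h2 ⊢
      simp only [Fintype.sum_sum_type, Sum.elim_inl, Sum.elim_inr, Finset.univ_unique,
        Finset.sum_singleton, mul_sub, Finset.sum_sub_distrib]
      have h3 : ∑ l, k (w i) (w l) * (c * a l) = c * ∑ l, k (w i) (w l) * a l := by
        rw [Finset.mul_sum]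
        exact Finset.sum_congr rfl fun l _ => by ring
      change _ + σ ^ 2 * a i = _ at h2
      change ∑ l, k (w i) (w l) * a l + σ ^ 2 * a i = _ at h2
      change ∑ l, k (w i) (w l) * b l + σ ^ 2 * b i = _ at h1
      rw [h3]
      linear_combination h1 - c * h2
    · rw [regMatrix_mulVec_apply]
      simp only [Fintype.sum_sum_type, Sum.elim_inl, Sum.elim_inr, Finset.univ_unique,
        Finset.sum_singleton, mul_sub, Finset.sum_sub_distrib]
      have h1 : ∑ l, k v (w l) * b l = m := by
        simp only [kernel_symm hk v]; rfl
      have h2 : ∑ l, k v (w l) * (c * a l) = c * (k v v - s) := by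
        rw [hs, posteriorVar_eq_weights, sub_sub_cancel, Finset.mul_sum]
        exact Finset.sum_congr rfl fun l _ => by rw [kernel_symm hk v, ha]; ring
      have h3 : c * (s + σ ^ 2) = e - m := div_mul_cancel₀ _ hs0.ne'
      rw [h1, h2]
      linear_combination h3
  rw [quadForm_eq_of_mulVec_eq hk hσ hx]
  have h4 : ∑ i, ε i * a i = m := by
    rw [hm, posteriorMean_eq_weights hk hσ]
    exact Finset.sum_congr rfl fun i _ => mul_comm _ _
  have h5 : quadForm k σ w ε = ∑ i, ε i * b i := rfl
  have h6 : (e - m) ^ 2 / (s + σ ^ 2) = c * (e - m) := by rw [hc]; ring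
  have h7 : ∑ i, ε i * (c * a i) = c * m := by
    rw [← h4, Finset.mul_sum]
    exact Finset.sum_congr rfl fun i _ => by ring
  simp only [dotProduct, Fintype.sum_sum_type, Sum.elim_inl, Sum.elim_inr, Finset.univ_unique,
    Finset.sum_singleton, mul_sub, Finset.sum_sub_distrib, h5, h6, h7]
  ring

lemma det_one_add_kernelMatrix (hσ : 0 < σ) (w : ι → W) :
    (1 + (σ ^ 2)⁻¹ • kernelMatrix k w).det =
      ((σ ^ 2)⁻¹) ^ Fintype.card ι * (regMatrix k σ w).det := by
  rw [← det_smul, regMatrix, smul_add, smul_smul, inv_mul_cancel₀ (by positivity), one_smul,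
    add_comm]

lemma infoGain_sumElim_unit (hk : ∀ v v', k v v' = inner ℝ (φ v) (φ v')) (hσ : 0 < σ)
    (w : ι → W) (v : W) :
    infoGain k σ (Sum.elim w fun _ : Unit => v) =
      infoGain k σ w + 1 / 2 * Real.log (1 + (σ ^ 2)⁻¹ * posteriorVar k σ w v) := by
  have h0 := (posDef_regMatrix hk hσ w).det_pos
  have h1 := posteriorVar_nonneg hk hσ w v
  have h2 : 0 < 1 + (σ ^ 2)⁻¹ * posteriorVar k σ w v := by positivity
  rw [infoGain, infoGain, det_one_add_kernelMatrix hσ, det_one_add_kernelMatrix hσ,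
    det_regMatrix_sumElim hk hσ, ← mul_add, ← Real.log_mul (by positivity) h2.ne']
  congr 2
  simp only [Fintype.card_sum, Fintype.card_unit, pow_succ]
  field_simp
  ring

lemma infoGain_comp_equiv {ι' : Type*} [Fintype ι'] [DecidableEq ι'] (k : W → W → ℝ) (σ : ℝ)
    (w : ι → W) (f : ι' ≃ ι) : infoGain k σ (fun i => w (f i)) = infoGain k σ w := by
  have : (1 + (σ ^ 2)⁻¹ • kernelMatrix k fun i => w (f i)) =
      (1 + (σ ^ 2)⁻¹ • kernelMatrix k w).submatrix f f := by
    ext i j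
    simp [kernelMatrix, Matrix.one_apply]
  rw [infoGain, this, det_submatrix_equiv_self, infoGain]

lemma quadForm_comp_equiv {ι' : Type*} [Fintype ι'] [DecidableEq ι'] (k : W → W → ℝ) (σ : ℝ)
    (w : ι → W) (ε : ι → ℝ) (f : ι' ≃ ι) :
    quadForm k σ (fun i => w (f i)) (fun i => ε (f i)) = quadForm k σ w ε := by
  have : regMatrix k σ (fun i => w (f i)) = (regMatrix k σ w).submatrix f f := by
    ext i j
    simp [regMatrix, kernelMatrix, Matrix.one_apply]
  rw [quadForm, this, inv_submatrix_equiv, submatrix_mulVec_equiv]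
  change (ε ∘ f) ⬝ᵥ (((regMatrix k σ w)⁻¹ *ᵥ ((ε ∘ f) ∘ f.symm)) ∘ f) = _
  rw [comp_equiv_dotProduct_comp_equiv, Function.comp_assoc, f.self_comp_symm, Function.comp_id]
  rfl

/-! ### Information gain -/

lemma infoGain_of_isEmpty [IsEmpty ι] (k : W → W → ℝ) (σ : ℝ) (w : ι → W) :
    infoGain k σ w = 0 := by
  simp [infoGain]

/-- `Fin (m + 1)` as the disjoint union of its first `m` elements and its last element. -/
def finSumUnit (m : ℕ) : Fin m ⊕ Unit ≃ Fin (m + 1) :=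
  (Equiv.optionEquivSumPUnit (Fin m)).symm.trans finSuccEquivLast.symm

/-- The reindexing that splits off the last element of the second family. -/
def sumFinSucc (ι : Type*) (m : ℕ) : (ι ⊕ Fin m) ⊕ Unit ≃ ι ⊕ Fin (m + 1) :=
  (Equiv.sumAssoc ι (Fin m) Unit).trans (Equiv.sumCongr (Equiv.refl ι) (finSumUnit m))

lemma comp_finSumUnit {α : Type*} (m : ℕ) (w : Fin (m + 1) → α) :
    (fun i => w (finSumUnit m i)) =
      Sum.elim (fun i => w i.castSucc) fun _ => w (Fin.last m) := by
  ext (i | i) <;> simp [finSumUnit]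

lemma sumElim_sumFinSucc {ι α : Type*} (m : ℕ) (w : ι → α) (w' : Fin (m + 1) → α) :
    (fun i => Sum.elim w w' (sumFinSucc ι m i)) =
      Sum.elim (Sum.elim w fun i => w' i.castSucc) fun _ => w' (Fin.last m) := by
  ext ((i | i) | i) <;> simp [sumFinSucc, finSumUnit]

lemma infoGain_fin_succ (hk : ∀ v v', k v v' = inner ℝ (φ v) (φ v')) (hσ : 0 < σ) (m : ℕ)
    (w : Fin (m + 1) → W) :
    infoGain k σ w = infoGain k σ (fun i : Fin m => w i.castSucc) +
      1 / 2 * Real.log (1 + (σ ^ 2)⁻¹ *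
        posteriorVar k σ (fun i : Fin m => w i.castSucc) (w (Fin.last m))) := by
  rw [← infoGain_sumElim_unit hk hσ, ← comp_finSumUnit, infoGain_comp_equiv]

lemma infoGain_sumElim_fin_succ (hk : ∀ v v', k v v' = inner ℝ (φ v) (φ v')) (hσ : 0 < σ) (m : ℕ)
    (w : ι → W) (w' : Fin (m + 1) → W) :
    infoGain k σ (Sum.elim w w') = infoGain k σ (Sum.elim w fun i : Fin m => w' i.castSucc) +
      1 / 2 * Real.log (1 + (σ ^ 2)⁻¹ *
        posteriorVar k σ (Sum.elim w fun i : Fin m => w' i.castSucc) (w' (Fin.last m))) := by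
  rw [← infoGain_sumElim_unit hk hσ, ← sumElim_sumFinSucc, infoGain_comp_equiv]

lemma infoGain_sumElim_empty (k : W → W → ℝ) (σ : ℝ) (w : ι → W) (w' : Fin 0 → W) :
    infoGain k σ (Sum.elim w w') = infoGain k σ w := by
  rw [← infoGain_comp_equiv k σ _ (Equiv.sumEmpty ι (Fin 0)).symm]
  rfl

lemma log_one_add_posteriorVar_nonneg (hk : ∀ v v', k v v' = inner ℝ (φ v) (φ v')) (hσ : 0 < σ)
    (w : ι → W) (v : W) : 0 ≤ Real.log (1 + (σ ^ 2)⁻¹ * posteriorVar k σ w v) := by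
  have := posteriorVar_nonneg hk hσ w v
  exact Real.log_nonneg (le_add_of_nonneg_right (by positivity))

lemma infoGain_le_sumElim (hk : ∀ v v', k v v' = inner ℝ (φ v) (φ v')) (hσ : 0 < σ) {m : ℕ}
    (w : ι → W) (w' : Fin m → W) : infoGain k σ w ≤ infoGain k σ (Sum.elim w w') := by
  induction m with
  | zero => rw [infoGain_sumElim_empty]
  | succ m ih =>
    rw [infoGain_sumElim_fin_succ hk hσ]
    have := log_one_add_posteriorVar_nonneg hk hσ (Sum.elim w fun i : Fin m => w' i.castSucc)
      (w' (Fin.last m))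
    linarith [ih fun i => w' i.castSucc]

/-- Each increment of the gain is a logarithm of a posterior variance, which only shrinks when the
points `w` are observed as well. -/
lemma infoGain_sumElim_le (hk : ∀ v v', k v v' = inner ℝ (φ v) (φ v')) (hσ : 0 < σ) {m : ℕ}
    (w : ι → W) (w' : Fin m → W) :
    infoGain k σ (Sum.elim w w') ≤ infoGain k σ w + infoGain k σ w' := by
  induction m with
  | zero => rw [infoGain_sumElim_empty, infoGain_of_isEmpty k σ w', add_zero]
  | succ m ih =>
    rw [infoGain_sumElim_fin_succ hk hσ, infoGain_fin_succ hk hσ m w']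
    have h := posteriorVar_le_comp hk hσ (Sum.elim w fun i : Fin m => w' i.castSucc)
      (w' (Fin.last m)) Sum.inr_injective
    have h0 := posteriorVar_nonneg hk hσ (Sum.elim w fun i : Fin m => w' i.castSucc)
      (w' (Fin.last m))
    have h1 : Real.log (1 + (σ ^ 2)⁻¹ * posteriorVar k σ
          (Sum.elim w fun i : Fin m => w' i.castSucc) (w' (Fin.last m))) ≤
        Real.log (1 + (σ ^ 2)⁻¹ * posteriorVar k σ (fun i : Fin m => w' i.castSucc)
          (w' (Fin.last m))) := by
      refine Real.log_le_log (by positivity) ?_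
      gcongr
      exact h
    linarith [ih fun i => w' i.castSucc]

lemma infoGain_comp_le {ι' : Type*} [Fintype ι'] [DecidableEq ι']
    (hk : ∀ v v', k v v' = inner ℝ (φ v) (φ v')) (hσ : 0 < σ) (w : ι → W) {f : ι' → ι}
    (hf : Function.Injective f) : infoGain k σ (fun i => w (f i)) ≤ infoGain k σ w := by
  classical
  -- The points outside the range of `f` are adjoined as a second block, which cannot decrease the
  -- gain.
  let e : ι' ⊕ Fin (Fintype.card ↥(Set.range f)ᶜ) ≃ ι :=
    (Equiv.sumCongr (Equiv.ofInjective f hf) (Fintype.equivFin _).symm).trans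
      (Equiv.Set.sumCompl (Set.range f))
  rw [← infoGain_comp_equiv k σ w e]
  have : (fun i => w (e i)) = Sum.elim (fun i => w (f i)) fun i => w (e (Sum.inr i)) := by
    ext (i | i) <;> simp [e]
  rw [this]
  exact infoGain_le_sumElim hk hσ _ _

lemma infoGain_nonneg (hk : ∀ v v', k v v' = inner ℝ (φ v) (φ v')) (hσ : 0 < σ) (w : ι → W) :
    0 ≤ infoGain k σ w := by
  have := infoGain_comp_le hk hσ w (f := (Fin.elim0 : Fin 0 → ι)) (fun i => i.elim0)
  rwa [infoGain_of_isEmpty] at this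

/-- Makes the supremum in `maxInfoGain` a genuine one: an unbounded real supremum would be the
default value 0. -/
lemma infoGain_le_of_bounded (hk : ∀ v v', k v v' = inner ℝ (φ v) (φ v')) (hσ : 0 < σ) {κ : ℝ}
    (hκ : ∀ v, k v v ≤ κ) {n : ℕ} (w : Fin n → W) :
    infoGain k σ w ≤ n * (1 / 2 * Real.log (1 + (σ ^ 2)⁻¹ * κ)) := by
  induction n with
  | zero => simp [infoGain_of_isEmpty]
  | succ n ih =>
    have h0 := posteriorVar_nonneg hk hσ (fun i : Fin n => w i.castSucc) (w (Fin.last n))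
    have h1 : Real.log (1 + (σ ^ 2)⁻¹ * posteriorVar k σ (fun i : Fin n => w i.castSucc)
          (w (Fin.last n))) ≤ Real.log (1 + (σ ^ 2)⁻¹ * κ) := by
      refine Real.log_le_log (by positivity) ?_
      gcongr
      exact (posteriorVar_le_self hk hσ _ _).trans (hκ _)
    rw [infoGain_fin_succ hk hσ]
    push_cast
    linarith [ih fun i => w i.castSucc]

lemma infoGain_le_maxInfoGain (hk : ∀ v v', k v v' = inner ℝ (φ v) (φ v')) (hσ : 0 < σ) {κ : ℝ}
    (hκ : ∀ v, k v v ≤ κ) {n : ℕ} (w : Fin n → W) :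
    infoGain k σ w ≤ maxInfoGain k σ n :=
  le_ciSup (f := fun w : Fin n → W => infoGain k σ w)
    ⟨_, by rintro _ ⟨w, rfl⟩; exact infoGain_le_of_bounded hk hσ hκ w⟩ w

lemma maxInfoGain_nonneg (hk : ∀ v v', k v v' = inner ℝ (φ v) (φ v')) (hσ : 0 < σ) (n : ℕ) :
    0 ≤ maxInfoGain k σ n :=
  Real.iSup_nonneg fun w => infoGain_nonneg hk hσ w

/-- Information gain of `m` batches of `n` observations. -/
lemma infoGain_prod_le (hk : ∀ v v', k v v' = inner ℝ (φ v) (φ v')) (hσ : 0 < σ) {κ : ℝ}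
    (hκ : ∀ v, k v v ≤ κ) {n m : ℕ} (w : Fin m × Fin n → W) :
    infoGain k σ w ≤ m * maxInfoGain k σ n := by
  induction m with
  | zero => simp [infoGain_of_isEmpty]
  | succ m ih =>
    let e : (Fin m × Fin n) ⊕ Fin n ≃ Fin (m + 1) × Fin n :=
      ((Equiv.sumCongr (Equiv.refl _) (Equiv.punitProd _).symm).trans
        (Equiv.sumProdDistrib _ _ _).symm).trans
          (Equiv.prodCongr (finSumUnit m) (Equiv.refl _))
    have h : (fun i => w (e i)) =
        Sum.elim (fun i => w (e (Sum.inl i))) fun i => w (e (Sum.inr i)) := by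
      ext (i | i) <;> rfl
    rw [← infoGain_comp_equiv k σ w e, h]
    refine (infoGain_sumElim_le hk hσ _ _).trans ?_
    have h1 := ih fun i => w (e (Sum.inl i))
    have h2 := infoGain_le_maxInfoGain hk hσ hκ fun i => w (e (Sum.inr i))
    push_cast
    linarith

/-- From `log (1 + x) ≥ x / (1 + x)` at `x = s / σ²`, together with `s ≤ κ`. -/
lemma posteriorVar_le_log (hk : ∀ v v', k v v' = inner ℝ (φ v) (φ v')) (hσ : 0 < σ) {κ : ℝ}
    (hκ : ∀ v, k v v ≤ κ) (w : ι → W) (v : W) :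
    posteriorVar k σ w v ≤
      (σ ^ 2 + κ) * Real.log (1 + (σ ^ 2)⁻¹ * posteriorVar k σ w v) := by
  set s := posteriorVar k σ w v
  have h0 : 0 ≤ s := posteriorVar_nonneg hk hσ w v
  have h1 : s ≤ κ := (posteriorVar_le_self hk hσ w v).trans (hκ v)
  have hp : 0 < 1 + (σ ^ 2)⁻¹ * s := by positivity
  have hc : 0 ≤ σ ^ 2 + κ := add_nonneg (sq_nonneg σ) (h0.trans h1)
  have h2 := Real.one_sub_inv_le_log_of_pos hp
  have h3 : 1 - (1 + (σ ^ 2)⁻¹ * s)⁻¹ = s / (σ ^ 2 + s) := by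
    have : σ ^ 2 + s ≠ 0 := by positivity
    field_simp
    ring
  rw [h3] at h2
  calc s = (σ ^ 2 + s) * (s / (σ ^ 2 + s)) := by field_simp
    _ ≤ (σ ^ 2 + κ) * Real.log (1 + (σ ^ 2)⁻¹ * s) := by gcongr

/-- The posterior variances at successively observed points sum up to at most a multiple of the
maximum information gain. -/
lemma sum_posteriorVar_le (hk : ∀ v v', k v v' = inner ℝ (φ v) (φ v')) (hσ : 0 < σ) {κ : ℝ}
    (hκ0 : 0 ≤ κ) (hκ : ∀ v, k v v ≤ κ) (w : ℕ → W) (n : ℕ) :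
    ∑ l ∈ Finset.range n, posteriorVar k σ (fun i : Fin l => w i) (w l) ≤
      2 * (σ ^ 2 + κ) * maxInfoGain k σ n := by
  have h : ∑ l ∈ Finset.range n, posteriorVar k σ (fun i : Fin l => w i) (w l) ≤
      2 * (σ ^ 2 + κ) * infoGain k σ (fun i : Fin n => w i) := by
    induction n with
    | zero => simp [infoGain_of_isEmpty]
    | succ n ih =>
      -- The information gains telescope; the constant 2 undoes the factor 1/2 in their definition.
      rw [Finset.sum_range_succ, infoGain_fin_succ hk hσ]
      have := posteriorVar_le_log hk hσ hκ (fun i : Fin n => w i) (w n)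
      simp only [Fin.val_castSucc, Fin.val_last]
      linarith
  refine h.trans (mul_le_mul_of_nonneg_left (infoGain_le_maxInfoGain hk hσ hκ _) (by positivity))

end Regression

/-! ### Likelihood ratios of Gaussian noise -/

section Likelihood

open Matrix ENNReal

variable {W ι : Type*} [Fintype ι] [DecidableEq ι]

/-- Likelihood ratio of the Gaussian process noise model `N(0, K + σ² I)` and of `N(0, σ² I)`. -/
def likelihoodRatio (k : W → W → ℝ) (σ : ℝ) (w : ι → W) (ε : ι → ℝ) : ℝ :=
  Real.exp (1 / 2 * ((σ ^ 2)⁻¹ * ∑ i, ε i ^ 2 - quadForm k σ w ε) - infoGain k σ w)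

lemma likelihoodRatio_comp_equiv {ι' : Type*} [Fintype ι'] [DecidableEq ι'] (k : W → W → ℝ)
    (σ : ℝ) (w : ι → W) (ε : ι → ℝ) (f : ι' ≃ ι) :
    likelihoodRatio k σ (fun i => w (f i)) (fun i => ε (f i)) = likelihoodRatio k σ w ε := by
  rw [likelihoodRatio, quadForm_comp_equiv, infoGain_comp_equiv,
    f.sum_comp fun i => ε i ^ 2, likelihoodRatio]

lemma likelihoodRatio_of_isEmpty [IsEmpty ι] (k : W → W → ℝ) (σ : ℝ) (w : ι → W) (ε : ι → ℝ) :
    likelihoodRatio k σ w ε = 1 := by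
  simp [likelihoodRatio, quadForm, infoGain_of_isEmpty]

lemma measurable_det {α : Type*} [MeasurableSpace α] {A : α → Matrix ι ι ℝ}
    (hA : ∀ i j, Measurable fun a => A a i j) : Measurable fun a => (A a).det := by
  simp only [det_apply]
  refine Finset.measurable_sum _ fun p _ => ?_
  exact (Finset.measurable_prod _ fun i _ => hA _ _).const_smul _

lemma measurable_likelihoodRatio {α : Type*} [MeasurableSpace α] [MeasurableSpace W]
    {k : W → W → ℝ} (hk : Measurable fun p : W × W => k p.1 p.2) (σ : ℝ) {w : α → ι → W}
    (hw : ∀ i, Measurable fun a => w a i) {ε : α → ι → ℝ} (hε : ∀ i, Measurable fun a => ε a i) :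
    Measurable fun a => likelihoodRatio k σ (w a) (ε a) := by
  have hK : ∀ i j, Measurable fun a => kernelMatrix k (w a) i j := fun i j =>
    hk.comp ((hw i).prodMk (hw j))
  have hR : ∀ i j, Measurable fun a => regMatrix k σ (w a) i j := fun i j =>
    (hK i j).add_const _
  have hinv : ∀ i j, Measurable fun a => (regMatrix k σ (w a))⁻¹ i j := by
    intro i j
    simp only [inv_def, Ring.inverse_eq_inv', Matrix.smul_apply, smul_eq_mul, adjugate_apply]
    refine (measurable_det hR).inv.mul (measurable_det fun i' j' => ?_)
    simp only [updateRow_apply]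
    split_ifs
    · exact measurable_const
    · exact hR i' j'
  have hI : Measurable fun a => infoGain k σ (w a) := by
    unfold infoGain
    refine (measurable_det fun i j => ?_).log.const_mul _
    exact ((hK i j).const_mul (σ ^ 2)⁻¹).const_add ((1 : Matrix ι ι ℝ) i j)
  have hQ : Measurable fun a => quadForm k σ (w a) (ε a) := by
    unfold quadForm dotProduct mulVec dotProduct
    exact Finset.measurable_sum _ fun i _ => (hε i).mul
      (Finset.measurable_sum _ fun j _ => (hinv i j).mul (hε j))
  unfold likelihoodRatio
  refine Measurable.exp (Measurable.sub (Measurable.const_mul (Measurable.sub ?_ hQ) _) hI)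
  exact (Finset.measurable_sum _ fun i _ => (hε i).pow_const 2).const_mul _

variable {H : Type*} [NormedAddCommGroup H] [InnerProductSpace ℝ H]
variable {k : W → W → ℝ} {φ : W → H} {σ : ℝ}

/-- Bayes' rule for one observation: the update of the ratio turns the noise density into the
predictive density of the Gaussian process. Its integral over `e` is 1, whence the martingale
property. -/
lemma gaussianPDFReal_mul_likelihoodRatio (hk : ∀ v v', k v v' = inner ℝ (φ v) (φ v'))
    (hσ : 0 < σ) (w : ι → W) (v : W) (ε : ι → ℝ) (e : ℝ) :
    gaussianPDFReal 0 (σ ^ 2).toNNReal e *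
        likelihoodRatio k σ (Sum.elim w fun _ : Unit => v) (Sum.elim ε fun _ => e) =
      likelihoodRatio k σ w ε * gaussianPDFReal (posteriorMean k σ w ε v)
        (posteriorVar k σ w v + σ ^ 2).toNNReal e := by
  have hs := posteriorVar_nonneg hk hσ w v
  rw [likelihoodRatio, likelihoodRatio, quadForm_sumElim hk hσ, infoGain_sumElim_unit hk hσ,
    gaussianPDFReal, gaussianPDFReal, Real.coe_toNNReal _ (by positivity),
    Real.coe_toNNReal _ (by positivity)]
  set s := posteriorVar k σ w v
  set m := posteriorMean k σ w ε v
  have hl : 1 / 2 * Real.log (1 + (σ ^ 2)⁻¹ * s) = Real.log (Real.sqrt (1 + (σ ^ 2)⁻¹ * s)) := by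
    rw [Real.log_sqrt (by positivity)]
    ring
  have hsq : Real.sqrt (2 * Real.pi * (s + σ ^ 2)) =
      Real.sqrt (2 * Real.pi * σ ^ 2) * Real.sqrt (1 + (σ ^ 2)⁻¹ * s) := by
    rw [← Real.sqrt_mul (by positivity)]
    congr 1
    field_simp
    ring
  have hp : 0 < Real.sqrt (1 + (σ ^ 2)⁻¹ * s) := Real.sqrt_pos.2 (by positivity)
  have hp' : 0 < Real.sqrt (2 * Real.pi * σ ^ 2) := Real.sqrt_pos.2 (by positivity)
  have hsp : s + σ ^ 2 ≠ 0 := by positivity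
  rw [hl, hsq, mul_inv]
  simp only [Fintype.sum_sum_type, Sum.elim_inl, Sum.elim_inr, Finset.univ_unique,
    Finset.sum_singleton]
  set S := ∑ i, ε i ^ 2
  set q := quadForm k σ w ε
  set I := infoGain k σ w
  set r := Real.sqrt (1 + (σ ^ 2)⁻¹ * s)
  have he : Real.exp (-(e - 0) ^ 2 / (2 * σ ^ 2)) *
      Real.exp (1 / 2 * ((σ ^ 2)⁻¹ * (S + e ^ 2) - (q + (e - m) ^ 2 / (s + σ ^ 2))) -
        (I + Real.log r)) =
      Real.exp (1 / 2 * ((σ ^ 2)⁻¹ * S - q) - I) * Real.exp (-(e - m) ^ 2 / (2 * (s + σ ^ 2))) *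
        r⁻¹ := by
    have hr : r⁻¹ = Real.exp (-Real.log r) := by rw [Real.exp_neg, Real.exp_log hp]
    rw [hr, ← Real.exp_add, ← Real.exp_add, ← Real.exp_add]
    congr 1
    field_simp
    ring
  rw [mul_assoc, he]
  ring

lemma lintegral_likelihoodRatio_unit (hk : ∀ v v', k v v' = inner ℝ (φ v) (φ v')) (hσ : 0 < σ)
    (w : ι → W) (v : W) (ε : ι → ℝ) :
    ∫⁻ e, ENNReal.ofReal (likelihoodRatio k σ (Sum.elim w fun _ : Unit => v)
        (Sum.elim ε fun _ => e)) ∂(gaussianReal 0 (σ ^ 2).toNNReal) =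
      ENNReal.ofReal (likelihoodRatio k σ w ε) := by
  have hv : (σ ^ 2).toNNReal ≠ 0 := by simpa using hσ.ne'
  have hv' : (posteriorVar k σ w v + σ ^ 2).toNNReal ≠ 0 := by
    have := posteriorVar_nonneg hk hσ w v
    simp only [ne_eq, Real.toNNReal_eq_zero, not_le]
    positivity
  have hpdf := measurable_gaussianPDF 0 (σ ^ 2).toNNReal
  rw [gaussianReal_of_var_ne_zero _ hv, lintegral_withDensity_eq_lintegral_mul_non_measurable _
    hpdf (by filter_upwards with x; exact gaussianPDF_lt_top)]
  have h : ∀ e, (gaussianPDF 0 (σ ^ 2).toNNReal * fun e => ENNReal.ofReal (likelihoodRatio k σ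
        (Sum.elim w fun _ : Unit => v) (Sum.elim ε fun _ => e))) e =
      ENNReal.ofReal (likelihoodRatio k σ w ε) * gaussianPDF (posteriorMean k σ w ε v)
        (posteriorVar k σ w v + σ ^ 2).toNNReal e := by
    intro e
    rw [Pi.mul_apply, gaussianPDF, gaussianPDF, ← ENNReal.ofReal_mul (gaussianPDFReal_nonneg _ _ _),
      gaussianPDFReal_mul_likelihoodRatio hk hσ,
      ENNReal.ofReal_mul (by rw [likelihoodRatio]; positivity)]
  rw [lintegral_congr h, lintegral_const_mul _ (measurable_gaussianPDF _ _),
    lintegral_gaussianPDF_eq_one _ hv', mul_one]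

/-- The likelihood ratio has mean `1` under independent Gaussian noise. -/
lemma lintegral_likelihoodRatio [MeasurableSpace W]
    (hkm : Measurable fun p : W × W => k p.1 p.2)
    (hk : ∀ v v', k v v' = inner ℝ (φ v) (φ v')) (hσ : 0 < σ) {m : ℕ}
    (w : ι → W) (w' : Fin m → W) (ε : ι → ℝ) :
    ∫⁻ e, ENNReal.ofReal (likelihoodRatio k σ (Sum.elim w w') (Sum.elim ε e))
        ∂(Measure.pi fun _ : Fin m => gaussianReal 0 (σ ^ 2).toNNReal) =
      ENNReal.ofReal (likelihoodRatio k σ w ε) := by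
  induction m with
  | zero =>
    have h : ∀ e : Fin 0 → ℝ, likelihoodRatio k σ (Sum.elim w w') (Sum.elim ε e) =
        likelihoodRatio k σ w ε := by
      intro e
      rw [← likelihoodRatio_comp_equiv k σ _ _ (Equiv.sumEmpty ι (Fin 0)).symm]
      rfl
    simp [h]
  | succ m ih =>
    have hmeas : Measurable fun e : Fin (m + 1) → ℝ =>
        ENNReal.ofReal (likelihoodRatio k σ (Sum.elim w w') (Sum.elim ε e)) := by
      refine (measurable_likelihoodRatio hkm σ (w := fun _ => Sum.elim w w')
        (ε := fun e => Sum.elim ε e) (fun i => measurable_const) ?_).ennreal_ofReal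
      rintro (i | i)
      · exact measurable_const
      · exact measurable_pi_apply i
    have hmp := (measurePreserving_piFinSuccAbove
      (fun _ : Fin (m + 1) => gaussianReal 0 (σ ^ 2).toNNReal) (Fin.last m)).symm
    rw [← hmp.lintegral_comp hmeas]
    -- The last noise variable is integrated first, with the others frozen; the remaining integral
    -- is the induction hypothesis.
    refine (lintegral_prod_symm _ (hmeas.comp hmp.measurable).aemeasurable).trans ?_
    have h : ∀ (e₀ : ℝ) (e : Fin m → ℝ), likelihoodRatio k σ (Sum.elim w w')
          (Sum.elim ε ((MeasurableEquiv.piFinSuccAbove (fun _ => ℝ) (Fin.last m)).symm (e₀, e))) =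
        likelihoodRatio k σ (Sum.elim (Sum.elim w fun i => w' i.castSucc)
          fun _ : Unit => w' (Fin.last m)) (Sum.elim (Sum.elim ε e) fun _ => e₀) := by
      intro e₀ e
      rw [← likelihoodRatio_comp_equiv k σ _ _ (sumFinSucc ι m), sumElim_sumFinSucc,
        sumElim_sumFinSucc]
      simp [MeasurableEquiv.piFinSuccAbove, Fin.insertNthEquiv]
    refine Eq.trans (lintegral_congr fun e => ?_) (ih fun i => w' i.castSucc)
    exact (lintegral_congr fun e₀ => congrArg ENNReal.ofReal (h e₀ e)).trans
      (lintegral_likelihoodRatio_unit hk hσ _ _ _)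

end Likelihood

/-! ### Ville's inequality and integration over independent variables -/

section Probability

open ENNReal

variable {Ω : Type*} [mΩ : MeasurableSpace Ω] {μ : Measure Ω}

lemma mul_measure_le_setLIntegral {f : Ω → ℝ≥0∞} {c : ℝ≥0∞} {D : Set Ω} (hD : MeasurableSet D)
    (h : ∀ ω ∈ D, c ≤ f ω) : c * μ D ≤ ∫⁻ ω in D, f ω ∂μ := by
  rw [← setLIntegral_const]
  exact setLIntegral_mono' hD h

/-- Ville's maximal inequality for nonnegative supermartingales. -/
lemma mul_measure_exists_ge_le (ℱ : Filtration ℕ mΩ) {M : ℕ → Ω → ℝ≥0∞}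
    (hM : ∀ n, Measurable[ℱ n] (M n))
    (hle : ∀ n A, MeasurableSet[ℱ n] A → ∫⁻ ω in A, M (n + 1) ω ∂μ ≤ ∫⁻ ω in A, M n ω ∂μ)
    (h0 : ∫⁻ ω, M 0 ω ∂μ ≤ 1) (c : ℝ≥0∞) : c * μ {ω | ∃ n, c ≤ M n ω} ≤ 1 := by
  let D : ℕ → Set Ω := fun n => {ω | c ≤ M n ω}
  let A : ℕ → Set Ω := fun n => {ω | ∃ l ≤ n, ω ∈ D l}
  have hD : ∀ n, MeasurableSet[ℱ n] (D n) := fun n => (hM n) measurableSet_Ici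
  have hA : ∀ n, MeasurableSet[ℱ n] (A n) := by
    intro n
    have : A n = ⋃ l ∈ Set.Iic n, D l := by ext ω; simp [A]
    rw [this]
    exact MeasurableSet.biUnion (Set.to_countable _) fun l hl => ℱ.mono hl _ (hD l)
  have hAs : ∀ n, A (n + 1) = A n ∪ (D (n + 1) \ A n) := by
    intro n
    ext ω
    simp only [A, Set.mem_ofPred_eq, Set.mem_union, Set.mem_sdiff, Nat.le_add_one_iff, or_and_right,
      exists_or, exists_eq_left]
    generalize (∃ l ≤ n, ω ∈ D l) = p
    tauto
  -- Optional stopping by hand: `A n` is the event that level `c` has been reached by time `n`.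
  -- Counting `c` there and the current value elsewhere gives a quantity that does not increase with
  -- `n`.
  have key : ∀ n, c * μ (A n) + ∫⁻ ω in (A n)ᶜ, M n ω ∂μ ≤ 1 := by
    intro n
    induction n with
    | zero =>
      have h : A 0 = D 0 := by ext ω; simp [A]
      have hm := ℱ.le 0 _ (hD 0)
      rw [h]
      refine le_trans ?_ ((lintegral_add_compl (M 0) hm).trans_le h0)
      exact add_le_add (mul_measure_le_setLIntegral hm fun ω h => h) le_rfl
    | succ n ih =>
      have hAn := ℱ.le n _ (hA n)
      have hDn := (ℱ.le (n + 1) _ (hD (n + 1))).diff hAn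
      refine le_trans ?_ ih
      have h1 : c * μ (A (n + 1)) ≤
          c * μ (A n) + ∫⁻ ω in D (n + 1) \ A n, M (n + 1) ω ∂μ := by
        rw [hAs]
        refine (mul_le_mul_right (measure_union_le _ _) c).trans ?_
        rw [mul_add]
        gcongr
        exact mul_measure_le_setLIntegral hDn fun ω h => h.1
      have h2 : (A n)ᶜ = (D (n + 1) \ A n) ∪ (A (n + 1))ᶜ := by
        rw [hAs]
        ext ω
        simp only [Set.mem_compl_iff, Set.mem_union, Set.mem_sdiff]
        tauto
      have h3 : Disjoint (D (n + 1) \ A n) (A (n + 1))ᶜ := by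
        rw [Set.disjoint_compl_right_iff_subset, hAs]
        exact Set.subset_union_right
      calc c * μ (A (n + 1)) + ∫⁻ ω in (A (n + 1))ᶜ, M (n + 1) ω ∂μ
          ≤ c * μ (A n) + ∫⁻ ω in D (n + 1) \ A n, M (n + 1) ω ∂μ +
              ∫⁻ ω in (A (n + 1))ᶜ, M (n + 1) ω ∂μ := by gcongr
        _ = c * μ (A n) + ∫⁻ ω in (A n)ᶜ, M (n + 1) ω ∂μ := by
            rw [h2, lintegral_union (ℱ.le (n + 1) _ (hA (n + 1))).compl h3, add_assoc]
        _ ≤ c * μ (A n) + ∫⁻ ω in (A n)ᶜ, M n ω ∂μ :=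
            add_le_add le_rfl (hle n _ (hA n).compl)
  have hU : {ω | ∃ n, c ≤ M n ω} = ⋃ n, A n := by
    ext ω
    simp only [A, D, Set.mem_ofPred_eq, Set.mem_iUnion]
    exact ⟨fun ⟨n, h⟩ => ⟨n, n, le_rfl, h⟩, fun ⟨_, l, _, h⟩ => ⟨l, h⟩⟩
  have hmono : Monotone A := fun m n hmn ω ⟨l, hl, h⟩ => ⟨l, hl.trans hmn, h⟩
  rw [hU, hmono.measure_iUnion, ENNReal.mul_iSup]
  exact iSup_le fun n => le_self_add.trans (key n)

lemma lintegral_prod_of_indepFun [IsProbabilityMeasure μ] {α β : Type*} [MeasurableSpace α]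
    [MeasurableSpace β] {Y : Ω → α} {Z : Ω → β} (hY : Measurable Y) (hZ : Measurable Z)
    (h : IndepFun Y Z μ) {g : α × β → ℝ≥0∞} (hg : Measurable g) :
    ∫⁻ ω, g (Y ω, Z ω) ∂μ = ∫⁻ ω, ∫⁻ z, g (Y ω, z) ∂(μ.map Z) ∂μ := by
  have := Measure.isProbabilityMeasure_map (μ := μ) hZ.aemeasurable
  rw [← lintegral_map (f := g) hg (hY.prodMk hZ),
    (indepFun_iff_map_prod_eq_prod_map_map hY.aemeasurable hZ.aemeasurable).1 h,
    lintegral_prod _ hg.aemeasurable, lintegral_map hg.lintegral_prod_right' hY]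

end Probability

/-! ### Measurability of the interaction and the noise martingale -/

section Control

variable {dx du : ℕ} {X : Set (Vec dx)} {U : Set (Vec du)} {S : Set ℝ}

lemma zDist_le_add (z z' : X × U) :
    zDist z z' ≤ ‖(z.1 : Vec dx) - (z'.1 : Vec dx)‖ + ‖(z.2 : Vec du) - (z'.2 : Vec du)‖ := by
  refine Real.sqrt_le_iff.2 ⟨by positivity, ?_⟩
  nlinarith [mul_nonneg (norm_nonneg ((z.1 : Vec dx) - (z'.1 : Vec dx)))
    (norm_nonneg ((z.2 : Vec du) - (z'.2 : Vec du)))]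

lemma zDist_le_dist (z z' : X × U) : zDist z z' ≤ 2 * dist z z' := by
  have h1 : ‖(z.1 : Vec dx) - (z'.1 : Vec dx)‖ ≤ dist z z' := by
    rw [← dist_eq_norm, ← Subtype.dist_eq, Prod.dist_eq]
    exact le_max_left _ _
  have h2 : ‖(z.2 : Vec du) - (z'.2 : Vec du)‖ ≤ dist z z' := by
    rw [← dist_eq_norm, ← Subtype.dist_eq, Prod.dist_eq]
    exact le_max_right _ _
  linarith [zDist_le_add z z']

/-- A Lipschitz policy evaluated at a random state is measurable. -/
lemma measurable_policy_apply {Ω : Type*} {m : MeasurableSpace Ω} {p : Ω → X → U}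
    (hp : ∀ x, Measurable fun ω => p ω x) (hc : ∀ ω, Continuous (p ω)) {x : Ω → X}
    (hx : Measurable x) : Measurable fun ω => p ω (x ω) := by
  have h := measurable_uncurry_of_continuous_of_measurable (u := fun (x : X) ω => p ω x) hc hp
  exact h.comp (hx.prodMk measurable_id)

namespace ControlProblem

variable {P : ControlProblem X U S} {Lh Lc Lπ : ℝ}

lemma IsLipschitz.continuous_hstar (h : P.IsLipschitz Lh Lc Lπ) (hLh : 0 ≤ Lh) (t : S) :
    Continuous fun z : X × U => P.hstar (z, t) := by
  refine LipschitzWith.continuous (K := (Lh * 2).toNNReal)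
    (LipschitzWith.of_dist_le_mul fun z z' => ?_)
  rw [Real.coe_toNNReal _ (by positivity), Subtype.dist_eq, dist_eq_norm, mul_assoc]
  exact (h.hstar t z z').trans (mul_le_mul_of_nonneg_left (zDist_le_dist z z') hLh)

lemma IsLipschitz.continuous_policy (h : P.IsLipschitz Lh Lc Lπ) (hLπ : 0 ≤ Lπ) {π : X → U}
    (hπ : π ∈ P.policies) : Continuous π := by
  refine LipschitzWith.continuous (K := Lπ.toNNReal)
    (LipschitzWith.of_dist_le_mul fun x x' => ?_)
  rw [Real.coe_toNNReal _ hLπ, Subtype.dist_eq, dist_eq_norm, Subtype.dist_eq, dist_eq_norm]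
  exact h.policy π hπ x x'

end ControlProblem

namespace Interaction

variable {Ω : Type*} [mΩ : MeasurableSpace Ω] {μ : Measure Ω}
variable {R : Interaction X U S Ω} {P : ControlProblem X U S} {L : LearnerParams X U S}
variable {Lh Lc Lπ : ℝ}

/-- The states of episode `n + 1` are known after episode `n`: the policy is predictable and
continuous in the state, hence jointly measurable, and the true dynamics is continuous. -/
lemma measurable_state (hP : P.IsLipschitz Lh Lc Lπ) (hLh : 0 ≤ Lh) (hLπ : 0 ≤ Lπ)
    (hR : R.IsOCoRL P L) (n l : ℕ) : Measurable[R.ℱ n] (R.state P (n + 1) l) := by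
  induction l with
  | zero => exact measurable_const
  | succ l ih =>
    refine (hP.continuous_hstar hLh (P.τ (0 + l))).measurable.comp (ih.prodMk ?_)
    exact measurable_policy_apply (hR.policy_predictable (n + 1) (by simp))
      (fun ω => hP.continuous_policy hLπ (hR.policy_mem (n + 1) (by simp) ω)) ih

lemma measurable_point (hP : P.IsLipschitz Lh Lc Lπ) (hLh : 0 ≤ Lh) (hLπ : 0 ≤ Lπ)
    (hR : R.IsOCoRL P L) (n l : ℕ) : Measurable[R.ℱ n] (R.point P (n + 1) l) := by
  have h := measurable_state hP hLh hLπ hR n l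
  refine (h.prodMk ?_).prodMk measurable_const
  exact measurable_policy_apply (hR.policy_predictable (n + 1) (by simp))
    (fun ω => hP.continuous_policy hLπ (hR.policy_mem (n + 1) (by simp) ω)) h

lemma measurable_measPoint (hP : P.IsLipschitz Lh Lc Lπ) (hLh : 0 ≤ Lh) (hLπ : 0 ≤ Lπ)
    (hR : R.IsOCoRL P L) (n : ℕ) {i : ℕ} (hi : i < L.numMeas P.T (n + 1)) :
    Measurable[R.ℱ n] (R.measPoint P (n + 1) i) := by
  -- The measurement time is random but takes countably many values, so measurability at each fixed
  -- step suffices.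
  have h : @Measurable (ℕ × Ω) _ (@Prod.instMeasurableSpace _ _ _ (R.ℱ n)) _
      fun p : ℕ × Ω => R.point P (n + 1) p.1 p.2 :=
    @measurable_from_prod_countable_right _ _ _ _ (R.ℱ n) _ _ _ _
      fun l => measurable_point hP hLh hLπ hR n l
  exact h.comp ((hR.time_predictable (n + 1) (by simp) i hi).prodMk
    (@measurable_id Ω (R.ℱ n)))

variable (R P L) in
/-- Likelihood ratio of the noise in the `j`-th coordinate of the measurements of the episodes
`1, …, n`. -/
def noiseRatio (j : Fin dx) (n : ℕ) (ω : Ω) : ℝ :=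
  likelihoodRatio L.k L.σ (fun p : DataIdx L P.T n => R.measPoint P (p.1 + 1) p.2 ω)
    fun p => R.noise (p.1 + 1) p.2 j ω

variable {σ : ℝ}

lemma measurable_past_point (hP : P.IsLipschitz Lh Lc Lπ) (hLh : 0 ≤ Lh) (hLπ : 0 ≤ Lπ)
    (hR : R.IsOCoRL P L) (n : ℕ) (p : DataIdx L P.T n) :
    Measurable[R.ℱ n] fun ω => R.measPoint P (p.1 + 1) p.2 ω :=
  (measurable_measPoint hP hLh hLπ hR p.1 p.2.2).mono (R.ℱ.mono p.1.2.le) le_rfl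

lemma measurable_past_noise (hN : R.IsGaussianNoise σ μ) (n : ℕ) (p : DataIdx L P.T n)
    (j : Fin dx) : Measurable[R.ℱ n] fun ω => R.noise (p.1 + 1) p.2 j ω :=
  (hN.adapted _ _ _).mono (R.ℱ.mono p.1.2) le_rfl

lemma measurable_noiseRatio (hP : P.IsLipschitz Lh Lc Lπ) (hLh : 0 ≤ Lh) (hLπ : 0 ≤ Lπ)
    (hR : R.IsOCoRL P L) (hN : R.IsGaussianNoise σ μ)
    (hkm : Measurable fun p : StepInput X U S × StepInput X U S => L.k p.1 p.2) (j : Fin dx)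
    (n : ℕ) : Measurable[R.ℱ n] (R.noiseRatio P L j n) :=
  @measurable_likelihoodRatio _ _ _ _ _ (R.ℱ n) _ _ hkm _ _
    (measurable_past_point hP hLh hLπ hR n) _ fun p => measurable_past_noise hN n p j

variable (L) in
/-- The measurements of the first `n + 1` episodes, split into those of the first `n` episodes and
those of the last one. -/
def dataIdxSucc (T n : ℕ) :
    DataIdx L T n ⊕ Fin (L.numMeas T (n + 1)) ≃ DataIdx L T (n + 1) :=
  Equiv.ofBijective (Sum.elim (fun p => ⟨p.1.castSucc, p.2⟩) fun i => ⟨Fin.last n, i⟩) <| by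
    constructor
    · rintro (⟨l, i⟩ | i) (⟨l', i'⟩ | i') h
      · simp only [Sum.elim_inl, Sigma.mk.injEq, Fin.castSucc_inj] at h
        obtain ⟨rfl, h⟩ := h
        rw [eq_of_heq h]
      · simp only [Sum.elim_inl, Sum.elim_inr, Sigma.mk.injEq] at h
        exact absurd h.1 (Fin.castSucc_lt_last l).ne
      · simp only [Sum.elim_inl, Sum.elim_inr, Sigma.mk.injEq] at h
        exact absurd h.1.symm (Fin.castSucc_lt_last l').ne
      · simp only [Sum.elim_inr, Sigma.mk.injEq, true_and] at h
        rw [eq_of_heq h]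
    · rintro ⟨l, i⟩
      induction l using Fin.lastCases with
      | last => exact ⟨Sum.inr i, rfl⟩
      | cast l => exact ⟨Sum.inl ⟨l, i⟩, rfl⟩

lemma noiseRatio_succ (j : Fin dx) (n : ℕ) (ω : Ω) :
    R.noiseRatio P L j (n + 1) ω = likelihoodRatio L.k L.σ
      (Sum.elim (fun p : DataIdx L P.T n => R.measPoint P (p.1 + 1) p.2 ω)
        fun i : Fin (L.numMeas P.T (n + 1)) => R.measPoint P (n + 1) i ω)
      (Sum.elim (fun p => R.noise (p.1 + 1) p.2 j ω) fun i => R.noise (n + 1) i j ω) := by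
  rw [noiseRatio, ← likelihoodRatio_comp_equiv _ _ _ _ (dataIdxSucc L P.T n)]
  congr 1 <;> ext (i | i) <;> rfl

lemma map_noise [IsProbabilityMeasure μ] (hN : R.IsGaussianNoise σ μ) (n m : ℕ) (j : Fin dx) :
    μ.map (fun ω (i : Fin m) => R.noise n i j ω) =
      Measure.pi fun _ => gaussianReal 0 (σ ^ 2).toNNReal := by
  have h : iIndepFun (fun (i : Fin m) => R.noise n i j) μ :=
    hN.indep.precomp (g := fun i : Fin m => (n, (i : ℕ), j)) fun i i' h => by
      simpa [Fin.val_inj] using h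
  rw [(iIndepFun_iff_map_fun_eq_pi_map (f := fun (i : Fin m) => R.noise n i j)
    fun i => (hN.law n i j).aemeasurable).1 h]
  simp only [(hN.law n _ j).map_eq]

open ENNReal in
/-- The likelihood ratios are a martingale. -/
lemma setLIntegral_noiseRatio_succ [IsProbabilityMeasure μ] {H : Type*} [NormedAddCommGroup H]
    [InnerProductSpace ℝ H] {φ : StepInput X U S → H} (hP : P.IsLipschitz Lh Lc Lπ) (hLh : 0 ≤ Lh)
    (hLπ : 0 ≤ Lπ) (hR : R.IsOCoRL P L) (hN : R.IsGaussianNoise σ μ) (hσ : 0 < σ) (hLσ : L.σ = σ)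
    (hkm : Measurable fun p : StepInput X U S × StepInput X U S => L.k p.1 p.2)
    (hk : ∀ v v', L.k v v' = inner ℝ (φ v) (φ v')) (j : Fin dx) (n : ℕ) {A : Set Ω}
    (hA : MeasurableSet[R.ℱ n] A) :
    ∫⁻ ω in A, ENNReal.ofReal (R.noiseRatio P L j (n + 1) ω) ∂μ =
      ∫⁻ ω in A, ENNReal.ofReal (R.noiseRatio P L j n ω) ∂μ := by
  subst hLσ
  set m := L.numMeas P.T (n + 1) with hm
  let W := StepInput X U S
  let I := DataIdx L P.T n
  -- `Y` gathers all that is known before episode `n + 1`, including the indicator of `A` and the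
  -- new measurement points; `Z` is the new noise. Independence then allows `Z` to be integrated out
  -- with `Y` frozen.
  let Y : Ω → ℝ≥0∞ × (I → W) × (I → ℝ) × (Fin m → W) := fun ω =>
    (A.indicator 1 ω, fun p => R.measPoint P (p.1 + 1) p.2 ω,
      fun p => R.noise (p.1 + 1) p.2 j ω, fun i => R.measPoint P (n + 1) i ω)
  let Z : Ω → Fin m → ℝ := fun ω i => R.noise (n + 1) i j ω
  let g : (ℝ≥0∞ × (I → W) × (I → ℝ) × (Fin m → W)) × (Fin m → ℝ) → ℝ≥0∞ := fun p =>
    p.1.1 * ENNReal.ofReal (likelihoodRatio L.k L.σ (Sum.elim p.1.2.1 p.1.2.2.2)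
      (Sum.elim p.1.2.2.1 p.2))
  have hYn : Measurable[R.ℱ n] Y := by
    refine Measurable.prodMk ?_ (Measurable.prodMk ?_ (Measurable.prodMk ?_ ?_))
    · exact Measurable.indicator (@measurable_const _ _ _ (R.ℱ n) 1) hA
    · exact @measurable_pi_lambda _ _ _ (R.ℱ n) _ _ (measurable_past_point hP hLh hLπ hR n)
    · exact @measurable_pi_lambda _ _ _ (R.ℱ n) _ _ fun p => measurable_past_noise hN n p j
    · exact @measurable_pi_lambda _ _ _ (R.ℱ n) _ _ fun i =>
        measurable_measPoint hP hLh hLπ hR n i.2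
  have hY : Measurable Y := hYn.mono (R.ℱ.le n) le_rfl
  have hZ : Measurable Z := measurable_pi_lambda _ fun i =>
    (hN.adapted (n + 1) i j).mono (R.ℱ.le _) le_rfl
  have hYZ : IndepFun Y Z μ := by
    change Indep _ _ μ
    refine (indep_of_indep_of_le_left (indep_of_indep_of_le_right (hN.indep_past (n + 1)
      (by simp)).symm ?_) hYn.comap_le)
    refine Measurable.comap_le ?_
    refine @measurable_pi_lambda _ _ _ (_) _ _ fun i => ?_
    refine Measurable.of_comap_le ?_
    exact (le_iSup (fun j => MeasurableSpace.comap (R.noise (n + 1) i j) inferInstance) j).trans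
      (le_iSup (fun i : ℕ => ⨆ j, MeasurableSpace.comap (R.noise (n + 1) i j) inferInstance) i)
  have hg : Measurable g := by
    refine (measurable_fst.comp measurable_fst).mul
      (measurable_likelihoodRatio hkm L.σ ?_ ?_).ennreal_ofReal
    · rintro (i | i)
      · exact (measurable_pi_apply i).comp (measurable_fst.comp
          (measurable_snd.comp measurable_fst))
      · exact (measurable_pi_apply i).comp (measurable_snd.comp (measurable_snd.comp
          (measurable_snd.comp measurable_fst)))
    · rintro (i | i)
      · exact (measurable_pi_apply i).comp (measurable_fst.comp (measurable_snd.comp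
          (measurable_snd.comp measurable_fst)))
      · exact (measurable_pi_apply i).comp measurable_snd
  have hind : ∀ f : Ω → ℝ≥0∞, ∫⁻ ω in A, f ω ∂μ = ∫⁻ ω, A.indicator 1 ω * f ω ∂μ := by
    intro f
    rw [← lintegral_indicator (R.ℱ.le n _ hA)]
    refine lintegral_congr fun ω => ?_
    by_cases h : ω ∈ A <;> simp [h]
  rw [hind, hind]
  simp only [noiseRatio_succ]
  refine (lintegral_prod_of_indepFun hY hZ hYZ hg).trans (lintegral_congr fun ω => ?_)
  simp only [g, Z]
  rw [lintegral_const_mul, map_noise hN, lintegral_likelihoodRatio hkm hk hσ]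
  · rfl
  · refine (measurable_likelihoodRatio hkm L.σ (w := fun _ => Sum.elim (Y ω).2.1 (Y ω).2.2.2)
      (ε := fun e => Sum.elim (Y ω).2.2.1 e) (fun i => measurable_const) ?_).ennreal_ofReal
    rintro (i | i)
    · exact measurable_const
    · exact measurable_pi_apply i

end Interaction

end Control

/-! ### Number of measurements and well-calibration -/

section Control

variable {dx du : ℕ} {X : Set (Vec dx)} {U : Set (Vec du)} {S : Set ℝ}

namespace LearnerParams

variable {L : LearnerParams X U S}

lemma one_le_bucketLength (T n : ℕ) : 1 ≤ L.bucketLength T n := le_max_left _ _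

lemma numMeas_le (T n : ℕ) : L.numMeas T n ≤ T := by
  refine Nat.ceil_le.2 (div_le_self (Nat.cast_nonneg T) ?_)
  exact_mod_cast L.one_le_bucketLength T n

lemma numMeas_eq_one {T n : ℕ} (hT : 1 ≤ T) (h : 2 * L.Gam n T * T ≤ 1) :
    L.numMeas T n = 1 := by
  classical
  have hb : L.bucketLength T n = T := by
    refine le_antisymm (max_le hT (Nat.findGreatest_le T)) (le_max_of_le_right ?_)
    exact Nat.le_findGreatest le_rfl h
  rw [numMeas, hb, div_self (by positivity), Nat.ceil_one]

/-- If no positive length qualifies, `Nat.findGreatest` returns 0 and the maximum raises it to 1;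
only then can the smallness condition fail. -/
lemma bucketLength_eq_one_or (T n : ℕ) :
    L.bucketLength T n = 1 ∨ 2 * L.Gam n (L.bucketLength T n) * L.bucketLength T n ≤ 1 := by
  classical
  by_cases h : Nat.findGreatest (fun Δ : ℕ => 2 * L.Gam n Δ * (Δ : ℝ) ≤ 1) T = 0
  · left
    rw [bucketLength, max_eq_left]
    refine le_trans (le_of_eq ?_) zero_le_one
    convert h
  · right
    have hb : L.bucketLength T n =
        Nat.findGreatest (fun Δ : ℕ => 2 * L.Gam n Δ * (Δ : ℝ) ≤ 1) T := by
      rw [bucketLength, max_eq_right]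
      rw [Nat.one_le_iff_ne_zero]
      convert h
    rw [hb]
    exact Nat.findGreatest_of_ne_zero (P := fun Δ : ℕ => 2 * L.Gam n Δ * (Δ : ℝ) ≤ 1) rfl h

/-- Let `C` be the coefficient of `β n`. If `C β_n ≥ T`, there are at most `T` measurements.
Otherwise the summand `T` of `C` forces `β_n ≤ 1`, so the growth factor is at most its value at `β =
1`, and the other summand yields `2 T Γ_n(T) ≤ 1`: one bucket. -/
lemma numMeas_le_max (T n : ℕ) (hT : 1 ≤ T) (hβ : 0 ≤ L.β n) (hLπ : 0 ≤ L.Lπ) (hLh : 0 ≤ L.Lh)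
    (hLσ : 0 ≤ L.Lσ) :
    (L.numMeas T n : ℝ) ≤ max 1 ((T + 4 * T ^ 2 * (L.Lσ * (1 + L.Lπ)) *
      (1 + L.Lh * (1 + L.Lπ) + 2 * (L.Lσ * (1 + L.Lπ))) ^ (T - 1)) * L.β n) := by
  set a := L.Lσ * (1 + L.Lπ) with ha
  set G := 1 + L.Lh * (1 + L.Lπ) + 2 * a with hG
  set C : ℝ := T + 4 * T ^ 2 * a * G ^ (T - 1) with hC
  have ha0 : 0 ≤ a := by positivity
  have hG0 : 0 ≤ G := by positivity
  have hT0 : (1 : ℝ) ≤ T := by exact_mod_cast hT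
  rcases le_or_gt (T : ℝ) (C * L.β n) with h | h
  · exact le_max_of_le_right (le_trans (by exact_mod_cast numMeas_le T n) h)
  · refine le_max_of_le_left ?_
    rw [numMeas_eq_one hT, Nat.cast_one]
    have hx : 0 ≤ 4 * (T : ℝ) ^ 2 * a * G ^ (T - 1) := by positivity
    have hb1 : L.β n ≤ 1 := by nlinarith
    have hg : L.growth n ≤ G := by
      rw [growth, hG, ← ha]
      nlinarith
    have hg0 : 0 ≤ L.growth n := by rw [growth]; positivity
    rw [Gam, ← ha]
    calc 2 * (2 * L.β n * a * L.growth n ^ (T - 1)) * T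
        ≤ 2 * (2 * L.β n * a * G ^ (T - 1)) * T := by gcongr
      _ = (4 * (T : ℝ) ^ 2 * a * G ^ (T - 1) * L.β n) / T := by field_simp; ring
      _ ≤ 1 := by
        rw [div_le_one (by positivity)]
        nlinarith

end LearnerParams

namespace Interaction

variable {Ω : Type*} [mΩ : MeasurableSpace Ω] {μ : Measure Ω}
variable {R : Interaction X U S Ω} {P : ControlProblem X U S} {L : LearnerParams X U S}
variable {Lh Lc Lπ σ κ : ℝ}
variable {H : Type*} [NormedAddCommGroup H] [InnerProductSpace ℝ H] {φ : StepInput X U S → H}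

lemma infoGain_data_le (hk : ∀ v v', L.k v v' = inner ℝ (φ v) (φ v')) (hσ : 0 < L.σ)
    (hκ : ∀ v, L.k v v ≤ κ) (n : ℕ) (ω : Ω) :
    infoGain L.k L.σ (fun p : DataIdx L P.T n => R.measPoint P (p.1 + 1) p.2 ω) ≤
      P.T * maxInfoGain L.k L.σ n := by
  -- Batch `i` consists of the `i`-th measurements of all `n` episodes, giving `T` batches of size
  -- `n`. Indices beyond the actual number of measurements add points, which can only increase the
  -- gain.
  let w : Fin P.T × Fin n → StepInput X U S := fun p => R.measPoint P (p.2 + 1) p.1 ω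
  let f : DataIdx L P.T n → Fin P.T × Fin n := fun p =>
    (p.2.castLE (L.numMeas_le P.T _), p.1)
  refine le_trans (infoGain_comp_le hk hσ w (f := f) ?_) (infoGain_prod_le hk hσ hκ w)
  rintro ⟨l, i⟩ ⟨l', i'⟩ h
  simp only [f, Prod.mk.injEq] at h
  obtain ⟨h1, rfl⟩ := h
  rw [Fin.castLE_inj] at h1
  rw [h1]

/-- The deviation of the true dynamics from the posterior mean on the event that the likelihood
ratio of the noise is less than `c`. -/
lemma abs_mean_sub_le (hk : ∀ v v', L.k v v' = inner ℝ (φ v) (φ v')) (hσ : 0 < L.σ)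
    (hκ : ∀ v, L.k v v ≤ κ) {B : ℝ} {j : Fin dx} {f : H} (hf : ‖f‖ ≤ B)
    (hfφ : ∀ w, inner ℝ f (φ w) = (P.hstar w : Vec dx) j) {c : ℝ} {n : ℕ} {ω : Ω}
    (hc : R.noiseRatio P L j n ω < c) (v : StepInput X U S) :
    |R.mean P L n ω j v - (P.hstar v : Vec dx) j| ≤
      (B + Real.sqrt (2 * Real.log c + 2 * (P.T * maxInfoGain L.k L.σ n))) *
        R.std P L n ω v j := by
  set w := fun p : DataIdx L P.T n => R.measPoint P (p.1 + 1) p.2 ω with hw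
  set ε := fun p : DataIdx L P.T n => R.noise (p.1 + 1) p.2 j ω with hε
  have hm : R.mean P L n ω j v =
      posteriorMean L.k L.σ w (fun i => inner ℝ f (φ (w i)) + ε i) v := by
    simp only [hfφ]
    rfl
  rw [hm, ← hfφ]
  refine (abs_posteriorMean_sub_le hk hσ w ε f v).trans ?_
  have hI := infoGain_data_le (R := R) (P := P) hk hσ hκ n ω
  have hl : 1 / 2 * ((L.σ ^ 2)⁻¹ * ∑ i, ε i ^ 2 - quadForm L.k L.σ w ε) - infoGain L.k L.σ w <
      Real.log c := by
    rwa [Real.lt_log_iff_exp_lt (lt_trans (Real.exp_pos _) hc)]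
  refine mul_le_mul_of_nonneg_right (add_le_add hf (Real.sqrt_le_sqrt ?_)) (Real.sqrt_nonneg _)
  linarith

/-- Maximal inequality for the likelihood ratios of all coordinates. -/
lemma exists_event_noiseRatio_lt [IsProbabilityMeasure μ] (hP : P.IsLipschitz Lh Lc Lπ)
    (hLh : 0 ≤ Lh) (hLπ : 0 ≤ Lπ) (hR : R.IsOCoRL P L) (hN : R.IsGaussianNoise σ μ) (hσ : 0 < σ)
    (hLσ : L.σ = σ) (hkm : Measurable fun p : StepInput X U S × StepInput X U S => L.k p.1 p.2)
    (hk : ∀ v v', L.k v v' = inner ℝ (φ v) (φ v')) {δ : ℝ} (hδ : 0 < δ) :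
    HoldsWithProb μ (1 - δ) fun ω => ∀ j n, R.noiseRatio P L j n ω < (dx + 1) / δ := by
  -- Each coordinate may fail with probability `δ / (dx + 1)`, for a union bound; the `+ 1` covers
  -- `dx = 0`.
  set c : ℝ := (dx + 1) / δ with hc
  have hc0 : 0 < c := by positivity
  let M : Fin dx → ℕ → Ω → ENNReal := fun j n ω => ENNReal.ofReal (R.noiseRatio P L j n ω)
  let F : Fin dx → Set Ω := fun j => {ω | ∃ n, ENNReal.ofReal c ≤ M j n ω}
  have hMn : ∀ j n, Measurable[R.ℱ n] (M j n) := fun j n =>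
    (measurable_noiseRatio hP hLh hLπ hR hN hkm j n).ennreal_ofReal
  have hF : ∀ j, MeasurableSet (F j) := by
    intro j
    have : F j = ⋃ n, {ω | ENNReal.ofReal c ≤ M j n ω} := by ext ω; simp [F]
    rw [this]
    exact MeasurableSet.iUnion fun n =>
      R.ℱ.le n _ ((hMn j n) measurableSet_Ici)
  have hFμ : ∀ j, μ (F j) ≤ ENNReal.ofReal (δ / (dx + 1)) := by
    intro j
    have h0 : ∫⁻ ω, M j 0 ω ∂μ ≤ 1 := by
      have : ∀ ω, M j 0 ω = 1 := fun ω => by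
        have : IsEmpty (DataIdx L P.T 0) := inferInstanceAs (IsEmpty ((_ : Fin 0) × _))
        simp only [M, noiseRatio]
        rw [likelihoodRatio_of_isEmpty, ENNReal.ofReal_one]
      simp [this]
    have h := mul_measure_exists_ge_le R.ℱ (hMn j) (fun n A hA =>
      (setLIntegral_noiseRatio_succ hP hLh hLπ hR hN hσ hLσ hkm hk j n hA).le) h0
      (ENNReal.ofReal c)
    have hcδ : δ / (dx + 1) = c⁻¹ := by rw [hc, inv_div]
    rw [hcδ, ENNReal.ofReal_inv_of_pos hc0, ENNReal.le_inv_iff_mul_le, mul_comm]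
    exact h
  refine ⟨(⋃ j, F j)ᶜ, (MeasurableSet.iUnion hF).compl, ?_, ?_⟩
  · rw [prob_compl_eq_one_sub (MeasurableSet.iUnion hF), ENNReal.ofReal_sub _ hδ.le,
      ENNReal.ofReal_one]
    refine tsub_le_tsub_left ?_ 1
    calc μ (⋃ j, F j) ≤ ∑ j, μ (F j) := measure_iUnion_fintype_le _ _
      _ ≤ ∑ _j : Fin dx, ENNReal.ofReal (δ / (dx + 1)) := Finset.sum_le_sum fun j _ => hFμ j
      _ = ENNReal.ofReal (dx * (δ / (dx + 1))) := by
          rw [Finset.sum_const, Finset.card_univ, Fintype.card_fin, nsmul_eq_mul,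
            ENNReal.ofReal_mul (by positivity), ENNReal.ofReal_natCast]
      _ ≤ ENNReal.ofReal δ := by
          refine ENNReal.ofReal_le_ofReal ?_
          rw [mul_div_assoc', div_le_iff₀ (by positivity)]
          nlinarith
  · intro ω hω j n
    by_contra! h
    exact hω (Set.mem_iUnion.2 ⟨j, n, ENNReal.ofReal_le_ofReal h⟩)

/-- Source of `C_β`: the last square root is at least 1 and absorbs `B`, and `T ≥ 1` lets the
product of the radicands dominate the sum. -/
lemma add_sqrt_le_mul_sqrt {B γ l T δ : ℝ} {d : ℕ} (hB : 0 ≤ B) (hγ : 0 ≤ γ) (hδ : 0 < δ)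
    (hδ1 : δ < 1) (hT : 1 ≤ T) (hl : l = Real.log ((d + 1) / δ)) :
    B + Real.sqrt (2 * l + 2 * (T * γ)) ≤
      (1 + B + Real.sqrt (2 * Real.log (d + 1) + 2 * T)) *
        Real.sqrt (1 + γ + Real.log (1 / δ)) := by
  have hlδ : 0 ≤ Real.log (1 / δ) := Real.log_nonneg ((one_le_div hδ).2 hδ1.le)
  have hld : 0 ≤ Real.log ((d : ℝ) + 1) := Real.log_nonneg (by simp)
  have hl' : l = Real.log (d + 1) + Real.log (1 / δ) := by
    rw [hl, ← Real.log_mul (by positivity) (by positivity), mul_one_div]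
  set x := Real.log (1 / δ)
  set y := Real.log ((d : ℝ) + 1)
  have h1 : 1 ≤ Real.sqrt (1 + γ + x) := Real.one_le_sqrt.2 (by linarith)
  have h2 : Real.sqrt (2 * l + 2 * (T * γ)) ≤
      Real.sqrt (2 * y + 2 * T) * Real.sqrt (1 + γ + x) := by
    rw [← Real.sqrt_mul (by positivity), hl']
    refine Real.sqrt_le_sqrt ?_
    nlinarith [mul_nonneg hld hγ, mul_nonneg hld hlδ, mul_nonneg (sub_nonneg.2 hT) hlδ]
  nlinarith

lemma wellCalibrated [IsProbabilityMeasure μ] (hP : P.IsLipschitz Lh Lc Lπ)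
    (hLh : 0 ≤ Lh) (hLπ : 0 ≤ Lπ) (hR : R.IsOCoRL P L) (hN : R.IsGaussianNoise σ μ) (hσ : 0 < σ)
    (hLσ : L.σ = σ) (hkm : Measurable fun p : StepInput X U S × StepInput X U S => L.k p.1 p.2)
    (hk : ∀ v v', L.k v v' = inner ℝ (φ v) (φ v')) (hκ : ∀ v, L.k v v ≤ κ) {B : ℝ} (hB : 0 ≤ B)
    (hf : ∀ j : Fin dx, ∃ f : H, ‖f‖ ≤ B ∧ ∀ w, inner ℝ f (φ w) = (P.hstar w : Vec dx) j)
    (hT : 1 ≤ P.T) {δ : ℝ} (hδ : 0 < δ) (hδ1 : δ < 1)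
    (hβ : ∀ n, (1 + B + Real.sqrt (2 * Real.log (dx + 1) + 2 * P.T)) *
      Real.sqrt (1 + maxInfoGain L.k σ n + Real.log (1 / δ)) ≤ L.β n) :
    R.WellCalibrated P L μ δ := by
  obtain ⟨E, hE, hμE, h⟩ := exists_event_noiseRatio_lt hP hLh hLπ hR hN hσ hLσ hkm hk hδ
  subst hLσ
  refine ⟨E, hE, hμE, fun ω hω n v j => ?_⟩
  obtain ⟨f, hfB, hfφ⟩ := hf j
  refine (abs_mean_sub_le hk hσ hκ hfB hfφ (h ω hω j n) v).trans ?_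
  refine mul_le_mul_of_nonneg_right (le_trans ?_ (hβ n)) (Real.sqrt_nonneg _)
  exact add_sqrt_le_mul_sqrt hB (maxInfoGain_nonneg hk hσ n) hδ hδ1 (by exact_mod_cast hT) rfl

end Interaction

end Control

/-! ### Deviation of trajectories and the regret bound -/

section Control

variable {dx du : ℕ} {X : Set (Vec dx)} {U : Set (Vec du)} {S : Set ℝ}

lemma rollout_add (h : StepInput X U S → X) (π : X → U) (τ : ℕ → S) (x : X) (s r : ℕ) :
    rollout h π τ 0 x (s + r) = rollout h π τ s (rollout h π τ 0 x s) r := by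
  induction r with
  | zero => rfl
  | succ r ih =>
    rw [← add_assoc, rollout, rollout, ih, zero_add]

/-- Discrete Gronwall inequality. -/
lemma le_pow_mul_sum_of_le {e d : ℕ → ℝ} {a g : ℝ} (he0 : e 0 ≤ 0) (hd : ∀ r, 0 ≤ d r)
    (ha : 0 ≤ a) (hag : a ≤ g) (hg : 1 ≤ g) (h : ∀ r, e (r + 1) ≤ a * e r + d r) (r : ℕ) :
    e r ≤ g ^ (r - 1) * ∑ l ∈ Finset.range r, d l := by
  induction r with
  | zero => simpa using he0
  | succ r ih =>
    have hs : 0 ≤ ∑ l ∈ Finset.range r, d l := Finset.sum_nonneg fun l _ => hd l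
    have h1 : a * e r ≤ g ^ r * ∑ l ∈ Finset.range r, d l := by
      -- For `r = 0` the exponent `r - 1` truncates to 0, and the vanishing initial deviation is
      -- used instead; this saves one power of `g`.
      rcases Nat.eq_zero_or_pos r with rfl | hr
      · simpa using mul_nonpos_of_nonneg_of_nonpos ha he0
      · calc a * e r ≤ a * (g ^ (r - 1) * ∑ l ∈ Finset.range r, d l) := by gcongr
          _ ≤ g * (g ^ (r - 1) * ∑ l ∈ Finset.range r, d l) := by gcongr
          _ = g ^ r * ∑ l ∈ Finset.range r, d l := by
            rw [← mul_assoc, ← pow_succ', Nat.sub_add_cancel hr]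
    have h2 : d r ≤ g ^ r * d r := le_mul_of_one_le_left (hd r) (one_le_pow₀ hg)
    rw [Finset.sum_range_succ, mul_add, Nat.add_sub_cancel]
    linarith [h r]

lemma zDist_policy_le {π : X → U} {Lπ : ℝ}
    (hπ : ∀ x x' : X, ‖(π x : Vec du) - (π x' : Vec du)‖ ≤ Lπ * ‖(x : Vec dx) - (x' : Vec dx)‖)
    (x x' : X) : zDist (x, π x) (x', π x') ≤ (1 + Lπ) * ‖(x : Vec dx) - (x' : Vec dx)‖ := by
  have := zDist_le_add (x, π x) (x', π x')
  linarith [hπ x x']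

/-- One step of the deviation between two dynamics, in terms of the uncertainty at the point of the
second trajectory. -/
lemma norm_step_sub_le {h h' : StepInput X U S → X} {π : X → U} {Lπ Lh' : ℝ}
    (hπ : ∀ x x' : X, ‖(π x : Vec du) - (π x' : Vec du)‖ ≤ Lπ * ‖(x : Vec dx) - (x' : Vec dx)‖)
    (hLh : 0 ≤ Lh') (hh : ∀ (t : S) (z z' : X × U),
      ‖(h (z, t) : Vec dx) - (h (z', t) : Vec dx)‖ ≤ Lh' * zDist z z')
    {s : StepInput X U S → ℝ} {b : ℝ}
    (hs : ∀ v, ‖(h v : Vec dx) - (h' v : Vec dx)‖ ≤ 2 * b * s v) (t : S) (x x' : X) :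
    ‖(h ((x, π x), t) : Vec dx) - (h' ((x', π x'), t) : Vec dx)‖ ≤
      Lh' * (1 + Lπ) * ‖(x : Vec dx) - (x' : Vec dx)‖ + 2 * b * s ((x', π x'), t) := by
  refine (norm_sub_le_norm_sub_add_norm_sub _ (h ((x', π x'), t) : Vec dx) _).trans ?_
  refine add_le_add ((hh t _ _).trans ?_) (hs _)
  rw [mul_assoc]
  exact mul_le_mul_of_nonneg_left (zDist_policy_le hπ x x') hLh

namespace Interaction

variable {Ω : Type*} [mΩ : MeasurableSpace Ω] {μ : Measure Ω}
variable {R : Interaction X U S Ω} {P : ControlProblem X U S} {L : LearnerParams X U S}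
variable {Lh Lc Lπ Lσ σ κ : ℝ}

lemma norm_sub_le_std {n : ℕ} {ω : Ω} {h h' : StepInput X U S → X} (hβ : 0 ≤ L.β n)
    (hh : h ∈ R.confSet P L n ω) (hh' : h' ∈ R.confSet P L n ω) (v : StepInput X U S) :
    ‖(h v : Vec dx) - (h' v : Vec dx)‖ ≤ 2 * L.β n * ‖R.std P L n ω v‖ := by
  have h2 : 2 * L.β n * ‖R.std P L n ω v‖ = ‖(2 * L.β n) • R.std P L n ω v‖ := by
    rw [norm_smul, Real.norm_of_nonneg (by positivity)]
  rw [h2, EuclideanSpace.norm_eq, EuclideanSpace.norm_eq]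
  refine Real.sqrt_le_sqrt (Finset.sum_le_sum fun j _ => ?_)
  refine pow_le_pow_left₀ (norm_nonneg _) ?_ 2
  have h3 := hh v j
  have h4 := hh' v j
  rw [PiLp.smul_apply, smul_eq_mul, PiLp.sub_apply, Real.norm_eq_abs, Real.norm_eq_abs]
  refine le_trans ?_ (le_abs_self _)
  calc |(h v : Vec dx) j - (h' v : Vec dx) j|
      = |(R.mean P L n ω j v - (h' v : Vec dx) j) - (R.mean P L n ω j v - (h v : Vec dx) j)| := by
        ring_nf
    _ ≤ _ := (abs_sub _ _).trans (by linarith)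

lemma norm_std (n : ℕ) (ω : Ω) (v : StepInput X U S) :
    ‖R.std P L n ω v‖ = Real.sqrt dx *
      posteriorStd L.k L.σ (fun p : DataIdx L P.T n => R.measPoint P (p.1 + 1) p.2 ω) v := by
  have h : 0 ≤ posteriorStd L.k L.σ
      (fun p : DataIdx L P.T n => R.measPoint P (p.1 + 1) p.2 ω) v := Real.sqrt_nonneg _
  rw [EuclideanSpace.norm_eq]
  simp [std, Real.sqrt_mul, Real.sqrt_sq h]

lemma one_le_growth (hLπ : 0 ≤ L.Lπ) (hLh : 0 ≤ L.Lh) (hLσ : 0 ≤ L.Lσ) {n : ℕ} (hβ : 0 ≤ L.β n) :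
    1 ≤ L.growth n := by
  have : 0 ≤ L.Lh * (1 + L.Lπ) + 2 * L.β n * (L.Lσ * (1 + L.Lπ)) := by positivity
  rw [LearnerParams.growth]
  linarith

lemma norm_hstar_sub_model_le (hR : R.IsOCoRL P L) (hβ0 : ∀ n, 0 ≤ L.β n) {n : ℕ} {ω : Ω}
    (hcal : P.hstar ∈ R.confSet P L n ω) (v : StepInput X U S) :
    ‖(P.hstar v : Vec dx) - (R.model (n + 1) ω v : Vec dx)‖ ≤
      2 * L.β n * ‖R.std P L n ω v‖ :=
  norm_sub_le_std (hβ0 n) hcal (hR.optimistic (n + 1) (by simp) ω ⟨_, hcal⟩).1 v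

/-- The uncertainty changes little between nearby states. -/
lemma abs_norm_std_sub_le (hP : P.IsLipschitz Lh Lc L.Lπ) (hR : R.IsOCoRL P L)
    (hS : R.StdLipschitz P L) (hLσ : 0 ≤ L.Lσ) (n : ℕ) (ω : Ω) (t : S) (x x' : X) :
    |‖R.std P L n ω ((x, R.policy (n + 1) ω x), t)‖ -
        ‖R.std P L n ω ((x', R.policy (n + 1) ω x'), t)‖| ≤
      L.Lσ * (1 + L.Lπ) * ‖(x : Vec dx) - (x' : Vec dx)‖ := by
  refine (abs_norm_sub_norm_le _ _).trans ((hS n ω t _ _).trans ?_)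
  rw [mul_assoc]
  exact mul_le_mul_of_nonneg_left
    (zDist_policy_le (hP.policy _ (hR.policy_mem (n + 1) (by simp) ω)) x x') hLσ

/-- Deviation of the hallucinated from the true trajectory, in terms of the uncertainty along the
hallucinated trajectory. -/
lemma norm_rollout_sub_le_hall (hP : P.IsLipschitz L.Lh Lc L.Lπ) (hR : R.IsOCoRL P L)
    (hLπ : 0 ≤ L.Lπ) (hLh : 0 ≤ L.Lh) (hLσ : 0 ≤ L.Lσ) (hβ0 : ∀ n, 0 ≤ L.β n) {n : ℕ} {ω : Ω}
    (hcal : P.hstar ∈ R.confSet P L n ω) (s : ℕ) (x : X) (r : ℕ) :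
    ‖(rollout P.hstar (R.policy (n + 1) ω) P.τ s x r : Vec dx) -
        (rollout (R.model (n + 1) ω) (R.policy (n + 1) ω) P.τ s x r : Vec dx)‖ ≤
      L.growth (n + 1) ^ (r - 1) * ∑ l ∈ Finset.range r, 2 * L.β n *
        ‖R.std P L n ω ((rollout (R.model (n + 1) ω) (R.policy (n + 1) ω) P.τ s x l,
          R.policy (n + 1) ω (rollout (R.model (n + 1) ω) (R.policy (n + 1) ω) P.τ s x l)),
          P.τ (s + l))‖ := by
  have hb := hβ0 n
  have hb' := hβ0 (n + 1)
  refine le_pow_mul_sum_of_le (a := L.Lh * (1 + L.Lπ)) (e := fun r =>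
    ‖(rollout P.hstar (R.policy (n + 1) ω) P.τ s x r : Vec dx) -
      (rollout (R.model (n + 1) ω) (R.policy (n + 1) ω) P.τ s x r : Vec dx)‖)
    (by simp [rollout]) (fun l => by positivity) (by positivity) ?_
    (one_le_growth hLπ hLh hLσ hb') (fun l => ?_) r
  · have : 0 ≤ 2 * L.β (n + 1) * (L.Lσ * (1 + L.Lπ)) := by positivity
    rw [LearnerParams.growth]
    linarith
  · exact norm_step_sub_le (hP.policy _ (hR.policy_mem (n + 1) (by simp) ω)) hLh hP.hstar
      (s := fun v => ‖R.std P L n ω v‖) (norm_hstar_sub_model_le hR hβ0 hcal) _ _ _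

/-- Deviation of the hallucinated from the true trajectory, in terms of the uncertainty along the
true trajectory. -/
lemma norm_rollout_sub_le_true (hP : P.IsLipschitz L.Lh Lc L.Lπ) (hR : R.IsOCoRL P L)
    (hS : R.StdLipschitz P L) (hLπ : 0 ≤ L.Lπ) (hLh : 0 ≤ L.Lh) (hLσ : 0 ≤ L.Lσ)
    (hβ0 : ∀ n, 0 ≤ L.β n) (hβ : Monotone L.β) {n : ℕ} {ω : Ω}
    (hcal : P.hstar ∈ R.confSet P L n ω) (r : ℕ) :
    ‖(R.state P (n + 1) r ω : Vec dx) -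
        (rollout (R.model (n + 1) ω) (R.policy (n + 1) ω) P.τ 0 P.x0 r : Vec dx)‖ ≤
      L.growth (n + 1) ^ (r - 1) * ∑ l ∈ Finset.range r, 2 * L.β n *
        ‖R.std P L n ω (R.point P (n + 1) l ω)‖ := by
  have hb := hβ0 n
  have hb' := hβ0 (n + 1)
  have hbb := hβ (Nat.le_succ n)
  refine le_pow_mul_sum_of_le (a := L.Lh * (1 + L.Lπ) + 2 * L.β n * (L.Lσ * (1 + L.Lπ)))
    (e := fun r => ‖(R.state P (n + 1) r ω : Vec dx) -
      (rollout (R.model (n + 1) ω) (R.policy (n + 1) ω) P.τ 0 P.x0 r : Vec dx)‖)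
    (by simp [rollout, state]) (fun l => by positivity) (by positivity) ?_
    (one_le_growth hLπ hLh hLσ hb') (fun l => ?_) r
  · have : 2 * L.β n * (L.Lσ * (1 + L.Lπ)) ≤ 2 * L.β (n + 1) * (L.Lσ * (1 + L.Lπ)) := by gcongr
    rw [LearnerParams.growth]
    linarith
  -- The step bound involves the uncertainty at the hallucinated point. Moving it to the true point
  -- costs `2 β_n L_σ'` times the deviation, which is absorbed into the growth rate.
  · have h1 := norm_step_sub_le (hP.policy _ (hR.policy_mem (n + 1) (by simp) ω)) hLh hP.hstar
      (s := fun v => ‖R.std P L n ω v‖) (norm_hstar_sub_model_le hR hβ0 hcal) (P.τ (0 + l))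
      (R.state P (n + 1) l ω)
      (rollout (R.model (n + 1) ω) (R.policy (n + 1) ω) P.τ 0 P.x0 l)
    have h2 := (abs_le.1 (abs_norm_std_sub_le hP hR hS hLσ n ω (P.τ (0 + l))
      (R.state P (n + 1) l ω)
      (rollout (R.model (n + 1) ω) (R.policy (n + 1) ω) P.τ 0 P.x0 l))).1
    refine h1.trans ?_
    have h3 : R.point P (n + 1) l ω = ((R.state P (n + 1) l ω,
        R.policy (n + 1) ω (R.state P (n + 1) l ω)), P.τ (0 + l)) := by
      rw [zero_add]; rfl
    rw [h3]
    nlinarith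

/-- Suboptimality of the policy of one episode. -/
lemma cost_sub_cost_le (hP : P.IsLipschitz L.Lh Lc L.Lπ) (hR : R.IsOCoRL P L)
    (hS : R.StdLipschitz P L) (hLc : 0 ≤ Lc) (hLπ : 0 ≤ L.Lπ) (hLh : 0 ≤ L.Lh) (hLσ : 0 ≤ L.Lσ)
    (hβ0 : ∀ n, 0 ≤ L.β n) (hβ : Monotone L.β) {n : ℕ} {ω : Ω}
    (hcal : P.hstar ∈ R.confSet P L n ω) {πstar : X → U} (hπ : πstar ∈ P.policies) :
    P.cost (R.policy (n + 1) ω) P.hstar - P.cost πstar P.hstar ≤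
      P.T * (Lc * (1 + L.Lπ) * (L.growth (n + 1) ^ (P.T - 1) * ∑ l ∈ Finset.range P.T,
        2 * L.β n * ‖R.std P L n ω (R.point P (n + 1) l ω)‖)) := by
  have hb := hβ0 n
  have hg := one_le_growth hLπ hLh hLσ (hβ0 (n + 1))
  -- Optimism: the true dynamics is plausible, so the pair `(πstar, hstar)` competes with the
  -- selected one.
  have hopt := (hR.optimistic (n + 1) (by simp) ω ⟨_, hcal⟩).2 πstar hπ _ hcal
  refine (sub_le_sub_left hopt _).trans ?_
  rw [ControlProblem.cost, ControlProblem.cost, ← Finset.sum_sub_distrib]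
  refine (Finset.sum_le_card_nsmul _ _ (Lc * (1 + L.Lπ) * (L.growth (n + 1) ^ (P.T - 1) *
    ∑ l ∈ Finset.range P.T, 2 * L.β n * ‖R.std P L n ω (R.point P (n + 1) l ω)‖))
    fun r hr => ?_).trans_eq (by simp)
  have hrT : r ≤ P.T := (Finset.mem_Icc.1 hr).2
  refine (le_abs_self _).trans ((hP.cost _ _).trans ?_)
  rw [mul_assoc]
  refine mul_le_mul_of_nonneg_left ?_ hLc
  refine (zDist_policy_le (hP.policy _ (hR.policy_mem (n + 1) (by simp) ω)) _ _).trans ?_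
  refine mul_le_mul_of_nonneg_left ?_ (by positivity)
  refine (norm_rollout_sub_le_true hP hR hS hLπ hLh hLσ hβ0 hβ hcal r).trans ?_
  refine mul_le_mul (pow_le_pow_right₀ hg (Nat.sub_le_sub_right hrT 1)) ?_
    (Finset.sum_nonneg fun l _ => by positivity) (by positivity)
  exact Finset.sum_le_sum_of_subset_of_nonneg (Finset.range_mono hrT)
    fun l _ _ => by positivity

/-- Within a bucket, true and hallucinated uncertainty differ by at most half of the maximum of the
latter. -/
lemma abs_std_hall_sub_le (hP : P.IsLipschitz L.Lh Lc L.Lπ) (hR : R.IsOCoRL P L)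
    (hS : R.StdLipschitz P L) (hLπ : 0 ≤ L.Lπ) (hLh : 0 ≤ L.Lh) (hLσ : 0 ≤ L.Lσ)
    (hβ0 : ∀ n, 0 ≤ L.β n) (hβ : Monotone L.β) {n : ℕ} {ω : Ω}
    (hcal : P.hstar ∈ R.confSet P L n ω) {i : ℕ} {D : ℝ} (hD : ∀ t ∈ L.bucket P.T (n + 1) i,
      ‖R.std P L n ω (R.hallPoint P L (n + 1) i ω t)‖ ≤ D) {t : ℕ}
    (ht : t ∈ L.bucket P.T (n + 1) i) :
    |‖R.std P L n ω (R.point P (n + 1) t ω)‖ -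
      ‖R.std P L n ω (R.hallPoint P L (n + 1) i ω t)‖| ≤ D / 2 := by
  have hb := hβ0 n
  have hbb := hβ (Nat.le_succ n)
  have hg := one_le_growth hLπ hLh hLσ (hβ0 (n + 1))
  have hD0 : 0 ≤ D := (norm_nonneg _).trans (hD t ht)
  set Δ := L.bucketLength P.T (n + 1) with hΔ
  set s := i * Δ with hs
  have htm := ht
  rw [LearnerParams.bucket, Finset.mem_Ico, lt_min_iff, ← hΔ, add_mul, one_mul, ← hs] at htm
  obtain ⟨r, rfl⟩ := Nat.exists_eq_add_of_le htm.1
  have hrΔ : r < Δ := by omega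
  have hhall : ∀ l, R.hallPoint P L (n + 1) i ω (s + l) =
      ((rollout (R.model (n + 1) ω) (R.policy (n + 1) ω) P.τ s (R.state P (n + 1) s ω) l,
        R.policy (n + 1) ω (rollout (R.model (n + 1) ω) (R.policy (n + 1) ω) P.τ s
          (R.state P (n + 1) s ω) l)), P.τ (s + l)) := by
    intro l
    simp only [hallPoint, ← hΔ, ← hs, Nat.add_sub_cancel_left]
  have hpoint : R.point P (n + 1) (s + r) ω =
      ((rollout P.hstar (R.policy (n + 1) ω) P.τ s (R.state P (n + 1) s ω) r,
        R.policy (n + 1) ω (rollout P.hstar (R.policy (n + 1) ω) P.τ s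
          (R.state P (n + 1) s ω) r)), P.τ (s + r)) := by
    simp only [point, state, rollout_add]
  rw [hpoint, hhall]
  refine (abs_norm_std_sub_le hP hR hS hLσ n ω _ _ _).trans ?_
  have hdev := norm_rollout_sub_le_hall hP hR hLπ hLh hLσ hβ0 hcal s (R.state P (n + 1) s ω) r
  have hsum : ∑ l ∈ Finset.range r, 2 * L.β n *
        ‖R.std P L n ω ((rollout (R.model (n + 1) ω) (R.policy (n + 1) ω) P.τ s
          (R.state P (n + 1) s ω) l, R.policy (n + 1) ω (rollout (R.model (n + 1) ω)
          (R.policy (n + 1) ω) P.τ s (R.state P (n + 1) s ω) l)), P.τ (s + l))‖ ≤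
      r * (2 * L.β n * D) := by
    refine (Finset.sum_le_card_nsmul _ _ (2 * L.β n * D) fun l hl => ?_).trans_eq (by simp)
    have hlr := Finset.mem_range.1 hl
    refine mul_le_mul_of_nonneg_left ?_ (by positivity)
    rw [← hhall]
    refine hD _ ?_
    rw [LearnerParams.bucket, Finset.mem_Ico, lt_min_iff, ← hΔ, add_mul, one_mul, ← hs]
    omega
  -- A one-step bucket contains only its starting state, where the trajectories agree. Otherwise `2
  -- Δ Γ(Δ) ≤ 1` is exactly what turns the Gronwall bound into `D / 2`.
  rcases L.bucketLength_eq_one_or P.T (n + 1) with h1 | h1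
  · have hr : r = 0 := by omega
    subst hr
    simp only [rollout, sub_self, norm_zero, mul_zero]
    positivity
  · rw [← hΔ, LearnerParams.Gam] at h1
    set a := L.Lσ * (1 + L.Lπ) with ha
    have ha0 : 0 ≤ a := by positivity
    have hrΔ' : (r : ℝ) ≤ Δ := by exact_mod_cast hrΔ.le
    have hpow : L.growth (n + 1) ^ (r - 1) ≤ L.growth (n + 1) ^ (Δ - 1) :=
      pow_le_pow_right₀ hg (by omega)
    calc a * _ ≤ a * (L.growth (n + 1) ^ (r - 1) * (r * (2 * L.β n * D))) :=
          mul_le_mul_of_nonneg_left (hdev.trans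
            (mul_le_mul_of_nonneg_left hsum (by positivity))) ha0
      _ ≤ a * (L.growth (n + 1) ^ (Δ - 1) * (Δ * (2 * L.β (n + 1) * D))) := by gcongr
      _ = (2 * (2 * L.β (n + 1) * a * L.growth (n + 1) ^ (Δ - 1)) * Δ) * (D / 2) := by ring
      _ ≤ D / 2 := mul_le_of_le_one_left (by positivity) h1

/-- One of the measured points of an episode is, up to a factor, as uncertain as any point of the
true trajectory. -/
lemma exists_measPoint_std_ge (hP : P.IsLipschitz L.Lh Lc L.Lπ) (hR : R.IsOCoRL P L)
    (hS : R.StdLipschitz P L) (hT : 1 ≤ P.T) (hLπ : 0 ≤ L.Lπ) (hLh : 0 ≤ L.Lh) (hLσ : 0 ≤ L.Lσ)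
    (hβ0 : ∀ n, 0 ≤ L.β n) (hβ : Monotone L.β) {n : ℕ} {ω : Ω}
    (hcal : P.hstar ∈ R.confSet P L n ω) :
    ∃ i < L.numMeas P.T (n + 1), ∀ t < P.T, ‖R.std P L n ω (R.point P (n + 1) t ω)‖ ≤
      3 * ‖R.std P L n ω (R.measPoint P (n + 1) i ω)‖ := by
  set Δ := L.bucketLength P.T (n + 1) with hΔ
  have hΔ1 : 1 ≤ Δ := L.one_le_bucketLength P.T (n + 1)
  have hloc : ∀ t < P.T, ∃ i < L.numMeas P.T (n + 1),
      ‖R.std P L n ω (R.point P (n + 1) t ω)‖ ≤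
        3 * ‖R.std P L n ω (R.measPoint P (n + 1) i ω)‖ := by
    intro t ht
    have hi : t / Δ < L.numMeas P.T (n + 1) := by
      rw [LearnerParams.numMeas, Nat.lt_ceil, ← hΔ, lt_div_iff₀ (by positivity)]
      exact_mod_cast (Nat.div_mul_le_self t Δ).trans_lt ht
    refine ⟨t / Δ, hi, ?_⟩
    have htb : t ∈ L.bucket P.T (n + 1) (t / Δ) := by
      rw [LearnerParams.bucket, Finset.mem_Ico, lt_min_iff, ← hΔ]
      exact ⟨Nat.div_mul_le_self t Δ, (Nat.div_lt_iff_lt_mul hΔ1).1 (Nat.lt_succ_self _), ht⟩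
    have hmax := hR.time_max (n + 1) (by simp) _ hi ω
    -- With `D` the hallucinated uncertainty at the measured step, the true uncertainty is at most
    -- `3D/2` at step `t` and at least `D/2` at the measured step: hence the factor 3.
    have h1 := abs_le.1 (abs_std_hall_sub_le hP hR hS hLπ hLh hLσ hβ0 hβ hcal hmax htb)
    have h2 := abs_le.1 (abs_std_hall_sub_le hP hR hS hLπ hLh hLσ hβ0 hβ hcal hmax
      (hR.time_mem (n + 1) (by simp) _ hi ω))
    have h3 := hmax t htb
    simp only [Nat.add_sub_cancel] at h1 h2 h3
    rw [measPoint]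
    linarith [h1.2, h2.1]
  have hne : (Finset.range (L.numMeas P.T (n + 1))).Nonempty := by
    obtain ⟨i, hi, -⟩ := hloc 0 hT
    exact ⟨i, Finset.mem_range.2 hi⟩
  -- The most uncertain measured point of the episode serves all steps simultaneously.
  obtain ⟨i, hi, hmax⟩ := Finset.exists_max_image _
    (fun i => ‖R.std P L n ω (R.measPoint P (n + 1) i ω)‖) hne
  refine ⟨i, Finset.mem_range.1 hi, fun t ht => ?_⟩
  obtain ⟨i', hi', h⟩ := hloc t ht
  linarith [hmax i' (Finset.mem_range.2 hi')]

variable {H : Type*} [NormedAddCommGroup H] [InnerProductSpace ℝ H] {φ : StepInput X U S → H}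

/-- The regret bound, if all the confidence sets contain the true dynamics. -/
lemma regret_le (hP : P.IsLipschitz L.Lh Lc L.Lπ) (hR : R.IsOCoRL P L) (hS : R.StdLipschitz P L)
    (hk : ∀ v v', L.k v v' = inner ℝ (φ v) (φ v')) (hκ : ∀ v, L.k v v ≤ κ) (hκ0 : 0 ≤ κ)
    (hσ : 0 < L.σ) (hT : 1 ≤ P.T) (hLc : 0 ≤ Lc) (hLπ : 0 ≤ L.Lπ) (hLh : 0 ≤ L.Lh)
    (hLσ : 0 ≤ L.Lσ) (hβ0 : ∀ n, 0 ≤ L.β n) (hβ : Monotone L.β) {ω : Ω}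
    (hcal : ∀ n, P.hstar ∈ R.confSet P L n ω) {πstar : X → U} (hπ : πstar ∈ P.policies) (N : ℕ) :
    R.regret P πstar N ω ≤ 6 * Lc * (1 + L.Lπ) * Real.sqrt dx * Real.sqrt (2 * (L.σ ^ 2 + κ)) *
      (L.β N * P.T ^ 2 * L.growth N ^ (P.T - 1) * Real.sqrt (N * maxInfoGain L.k L.σ N)) := by
  choose i hi hmax using fun n =>
    exists_measPoint_std_ge hP hR hS hT hLπ hLh hLσ hβ0 hβ (hcal n)
  let w : ℕ → StepInput X U S := fun n => R.measPoint P (n + 1) (i n) ω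
  let p : ℕ → ℝ := fun n =>
    posteriorStd L.k L.σ (fun q : DataIdx L P.T n => R.measPoint P (q.1 + 1) q.2 ω) (w n)
  have hp : ∀ n, 0 ≤ p n := fun n => Real.sqrt_nonneg _
  have hb := hβ0 N
  have hgN := one_le_growth hLπ hLh hLσ hb
  have hstep : ∀ n ∈ Finset.range N,
      P.cost (R.policy (n + 1) ω) P.hstar - P.cost πstar P.hstar ≤
        6 * Lc * (1 + L.Lπ) * Real.sqrt dx * (L.β N * P.T ^ 2 * L.growth N ^ (P.T - 1)) * p n := by
    intro n hn
    have hnN : n + 1 ≤ N := Finset.mem_range.1 hn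
    have hbn := hβ0 n
    have hg1 := one_le_growth hLπ hLh hLσ (hβ0 (n + 1))
    have hg : L.growth (n + 1) ≤ L.growth N := by
      have := hβ hnN
      rw [LearnerParams.growth, LearnerParams.growth]
      gcongr
    have hbN : L.β n ≤ L.β N := hβ ((Nat.le_succ n).trans hnN)
    refine (cost_sub_cost_le hP hR hS hLc hLπ hLh hLσ hβ0 hβ (hcal n) hπ).trans ?_
    have hsum : ∑ l ∈ Finset.range P.T, 2 * L.β n * ‖R.std P L n ω (R.point P (n + 1) l ω)‖ ≤
        P.T * (2 * L.β N * (3 * (Real.sqrt dx * p n))) := by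
      refine (Finset.sum_le_card_nsmul _ _ (2 * L.β N * (3 * (Real.sqrt dx * p n)))
        fun l hl => ?_).trans_eq (by simp)
      refine mul_le_mul (by linarith) ?_ (norm_nonneg _) (by positivity)
      rw [← norm_std]
      exact hmax n l (Finset.mem_range.1 hl)
    -- The constant 6 is 2 (width of the confidence band) times 3 (measurement selection). One
    -- factor `T` counts the cost terms, the other the summed uncertainties.
    calc _ ≤ P.T * (Lc * (1 + L.Lπ) * (L.growth N ^ (P.T - 1) *
          (P.T * (2 * L.β N * (3 * (Real.sqrt dx * p n)))))) := by gcongr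
      _ = _ := by ring
  have hvar : ∑ n ∈ Finset.range N, p n ^ 2 ≤
      2 * (L.σ ^ 2 + κ) * maxInfoGain L.k L.σ N := by
    refine le_trans (Finset.sum_le_sum fun n _ => ?_) (sum_posteriorVar_le hk hσ hκ0 hκ w N)
    simp only [p]
    rw [posteriorStd_sq hk hσ]
    -- Discarding all but one measurement per past episode increases the variance, so the sum is
    -- governed by `γ_N` and not by the gain of all the data.
    refine posteriorVar_le_comp hk hσ
      (fun q : DataIdx L P.T n => R.measPoint P (q.1 + 1) q.2 ω) (w n)
      (f := fun l : Fin n => ⟨l, ⟨i l, hi l⟩⟩) fun l l' h => ?_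
    exact (Sigma.mk.inj h).1
  have hsum : ∑ n ∈ Finset.range N, p n ≤
      Real.sqrt (2 * (L.σ ^ 2 + κ)) * Real.sqrt (N * maxInfoGain L.k L.σ N) := by
    rw [← Real.sqrt_mul (by positivity)]
    refine Real.le_sqrt_of_sq_le ?_
    refine sq_sum_le_card_mul_sum_sq.trans ?_
    rw [Finset.card_range]
    calc (N : ℝ) * ∑ n ∈ Finset.range N, p n ^ 2
        ≤ N * (2 * (L.σ ^ 2 + κ) * maxInfoGain L.k L.σ N) := by gcongr
      _ = _ := by ring
  have hreg : R.regret P πstar N ω = ∑ n ∈ Finset.range N,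
      (P.cost (R.policy (n + 1) ω) P.hstar - P.cost πstar P.hstar) := by
    rw [regret, Finset.range_eq_Ico, Finset.sum_Ico_add' (fun n =>
      P.cost (R.policy n ω) P.hstar - P.cost πstar P.hstar) 0 N 1]
    rfl
  rw [hreg]
  refine (Finset.sum_le_sum hstep).trans ?_
  rw [← Finset.mul_sum]
  refine (mul_le_mul_of_nonneg_left hsum (by positivity)).trans_eq ?_
  ring

end Interaction

/-- The reproducing property supplies the feature map required by the regression lemmas. -/
lemma rkhsKernel_eq_inner {W : Type*} (H : Type*) [NormedAddCommGroup H] [InnerProductSpace ℝ H]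
    [CompleteSpace H] [RKHS ℝ H W ℝ] (w w' : W) :
    rkhsKernel H w w' = inner ℝ (RKHS.kerFun H w (1 : ℝ)) (RKHS.kerFun H w' (1 : ℝ)) := by
  rw [rkhsKernel, RKHS.kerFun_inner, RKHS.kerFun_apply]
  simp

end Control

end

theorem mainTheorem7 (dx : ℕ) (Lc Lπ σ κ : ℝ) (hLc : 0 ≤ Lc) (hLπ : 0 ≤ Lπ) (hσ : 0 < σ)
    (hκ : 0 ≤ κ) :
    ∃ CR : ℝ, 0 < CR ∧ ∀ (T : ℕ) (B : ℝ), 1 ≤ T → 0 ≤ B →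
    ∃ Cβ : ℝ, 1 ≤ Cβ ∧ ∀ (Lh Lσ : ℝ), 0 ≤ Lh → 0 ≤ Lσ →
    ∃ Cm : ℝ, 0 < Cm ∧
    ∀ (du : ℕ) (X : Set (Vec dx)) (U : Set (Vec du)) (S : Set ℝ) (_ : S ⊆ Set.Ioi 0)
      (H : Type*) [NormedAddCommGroup H] [InnerProductSpace ℝ H] [CompleteSpace H]
      [RKHS ℝ H (StepInput X U S) ℝ]
      (Ω : Type*) [MeasurableSpace Ω] (μ : Measure Ω) [IsProbabilityMeasure μ]
      (P : ControlProblem X U S) (L : LearnerParams X U S) (R : Interaction X U S Ω)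
      (δ : ℝ) (πstar : X → U),
      -- the parameters
      P.T = T → L.k = rkhsKernel H → L.σ = σ → L.Lπ = Lπ → L.Lh = Lh → L.Lσ = Lσ →
      (∀ n, 0 ≤ L.β n) → Monotone L.β → 0 < δ → δ < 1 →
      -- the kernel is measurable and bounded
      Measurable (fun p : StepInput X U S × StepInput X U S => rkhsKernel H p.1 p.2) →
      (∀ w : StepInput X U S, rkhsKernel H w w ≤ κ) →
      -- the assumptions on the system and on the learner
      P.IsLipschitz Lh Lc Lπ → P.InRKHSBall H B →
      R.IsGaussianNoise σ μ → R.IsOCoRL P L → R.StdLipschitz P L →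
      -- `πstar` is an optimal policy
      πstar ∈ P.policies → (∀ π ∈ P.policies, P.cost πstar P.hstar ≤ P.cost π P.hstar) →
      -- well-calibration, for confidence widths of order `√(γ_n + log (1 / δ))`
      ((∀ n, Cβ * Real.sqrt (1 + maxInfoGain L.k σ n + Real.log (1 / δ)) ≤ L.β n) →
        R.WellCalibrated P L μ δ) ∧
      -- the regret bound
      (R.WellCalibrated P L μ δ →
        HoldsWithProb μ (1 - δ) fun ω => ∀ N, 1 ≤ N →
          R.regret P πstar N ω ≤
            CR * (L.β N * (T : ℝ) ^ 2 *
              (1 + Lh * (1 + Lπ) + 2 * L.β N * (Lσ * (1 + Lπ))) ^ (T - 1) *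
              Real.sqrt (N * maxInfoGain L.k σ N))) ∧
      -- the number of measurements
      (∀ n, 1 ≤ n → (L.numMeas T n : ℝ) ≤ max 1 (Cm * L.β n)) := by
  -- The added 1 keeps `CR` positive when `Lc = 0` or `dx = 0`.
  refine ⟨6 * Lc * (1 + Lπ) * Real.sqrt dx * Real.sqrt (2 * (σ ^ 2 + κ)) + 1, by positivity,
    fun T B hT hB => ⟨1 + B + Real.sqrt (2 * Real.log (dx + 1) + 2 * T), ?_,
    fun Lh Lσ hLh hLσ => ⟨T + 4 * T ^ 2 * (Lσ * (1 + Lπ)) *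
      (1 + Lh * (1 + Lπ) + 2 * (Lσ * (1 + Lπ))) ^ (T - 1), ?_, ?_⟩⟩⟩
  · have := Real.sqrt_nonneg (2 * Real.log ((dx : ℝ) + 1) + 2 * T)
    linarith
  · have : (0 : ℝ) < T := by exact_mod_cast hT
    positivity
  intro du X U S _ H _ _ _ _ Ω _ μ _ P L R δ πstar hPT hLk hLσσ hLLπ hLLh hLLσ hβ0 hβ hδ hδ1
    hkm hκb hP hB' hN hR hS hπ _
  subst hPT hLσσ hLLπ hLLh hLLσ
  have hk : ∀ v v', L.k v v' = inner ℝ (RKHS.kerFun H v (1 : ℝ)) (RKHS.kerFun H v' (1 : ℝ)) := by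
    intro v v'
    rw [hLk, rkhsKernel_eq_inner]
  have hκ' : ∀ v, L.k v v ≤ κ := by rwa [hLk]
  refine ⟨fun hβC => ?_, fun ⟨E, hE, hμE, hcal⟩ => ⟨E, hE, hμE, fun ω hω N _ => ?_⟩, fun n _ => ?_⟩
  · refine Interaction.wellCalibrated hP hLh hLπ hR hN hσ rfl (by rwa [hLk]) hk hκ' hB
      (fun j => ?_) hT hδ hδ1 hβC
    obtain ⟨f, hf, hfw⟩ := hB' j
    refine ⟨f, hf, fun w => ?_⟩
    rw [RKHS.inner_kerFun, hfw]
    simp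
  · have h := Interaction.regret_le hP hR hS hk hκ' hκ hσ hT hLc hLπ hLh hLσ hβ0 hβ
      (hcal ω hω) hπ N
    have hg := Interaction.one_le_growth hLπ hLh hLσ (hβ0 N)
    have hb := hβ0 N
    refine h.trans (mul_le_mul_of_nonneg_right (le_add_of_nonneg_right zero_le_one) ?_)
    positivity
  · exact L.numMeas_le_max P.T n hT (hβ0 n) hLπ hLh hLσ
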